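/- Let $d\ge 1$, let $\Omega\subset\mathbb R^d$ be a nonempty bounded open set (for instance a bounded domain with Lipschitz boundary), and let $S_0,S_1\subset\Omega$ be disjoint measurable sets such that $\tilde\Omega:=\Omega\setminus(S_0\cup S_1)$ is open. Let $-1<\beta_1\le\beta_2<1$, $\varepsilon>0$, $\gamma>0$, and let $a_\varepsilon,b_\varepsilon,c_\varepsilon,\psi_0\in C^{1,1}_{\mathrm{loc}}(\mathbb R)$ with $a_\varepsilon,c_\varepsilon>C_\varepsilon$ on $\mathbb R$ for some constant $C_\varepsilon>0$ and $b_\varepsilon\ge 0$ on $\mathbb R$. Put $$\mathcal G^\beta=\Big\{\varphi\in H^1(\tilde\Omega):\ |\varphi|\le 1 \text{ a.e.},\ \beta_1|\tilde\Omega|\le\int_{\tilde\Omega}\varphi\,dx\le\beta_2|\tilde\Omega|\Big\},\qquad \mathcal U=\{\varphi\in L^1(\Omega):\ \varphi=-1\text{ a.e. on }S_0,\ \varphi=1\text{ a.e. on }S_1\}.$$ For $f:\Omega\to\mathbb R$ write $(u,v)_f=\int_\Omega f\,u\cdot v\,dx$, for scalar or vector valued $u,v$. For $\varphi\in\mathcal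 G^\beta\cap\mathcal U$, a number $\lambda$ is an eigenvalue with eigenfunction $w$ if $0\ne w\in H^1_0(\Omega)$ and $$(\nabla w,\nabla\eta)_{a_\varepsilon(\varphi)}+(w,\eta)_{b_\varepsilon(\varphi)}=\lambda\,(w,\eta)_{c_\varepsilon(\varphi)}\quad\text{for all }\eta\in H^1_0(\Omega).\tag{1}$$ Let $\lambda_1^\varphi\le\lambda_2^\varphi\le\cdots$ be the eigenvalues in nondecreasing order, repeated according to multiplicity; an eigenvalue is simple if its eigenspace is one-dimensional. Fix indices $1\le i_1<\dots<i_l$ and $\Psi\in C^1((\mathbb R_{>0})^l;\mathbb R)$, and put $$J(\varphi)=\Psi(\lambda^\varphi_{i_1},\dots,\lambda^\varphi_{i_l})+\gamma\int_{\tilde\Omega}\Big(\frac\varepsilon2|\nabla\varphi|^2+\frac1\varepsilon\psi_0(\varphi)\Big)dx .$$ Let $\varphi\in\mathcal G^\beta\cap\mathcal U$ be a local minimizer, i.e. there is $\delta>0$ such that $J(\vartheta)\ge J(\varphi)$ for all $\vartheta\in\mathcal G^\beta\cap\mathcal U$ with $\|\vartheta-\varphi\|_{L^\infty(\Omega)}<\delta$,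 and suppose that the eigenvalues $\lambda^\varphi_{i_1},\dots,\lambda^\varphi_{i_l}$ are simple. Then there exist eigenfunctions $w_j\in H^1_0(\Omega)$ to $\lambda^\varphi_{i_j}$, normalized by $(w_j,w_j)_{c_\varepsilon(\varphi)}=1$, $j=1,\dots,l$, and for every choice of such eigenfunctions the following holds. 1. For every $j\in\{1,\dots,l\}$ the state equation $$-\nabla\cdot[a_\varepsilon(\varphi)\nabla w_j]+b_\varepsilon(\varphi)w_j=\lambda^\varphi_{i_j}c_\varepsilon(\varphi)w_j\ \text{ in }\Omega,\qquad w_j=0\ \text{ on }\partial\Omega,$$ is fulfilled in the weak sense, i.e. $w_j\in H^1_0(\Omega)$ satisfies (1) with $\lambda=\lambda^\varphi_{i_j}$. 2. For all $\vartheta\in\mathcal G^\beta\cap\mathcal U$, $$0\le\gamma\varepsilon\int_{\tilde\Omega}\nabla\varphi\cdot\nabla(\vartheta-\varphi)\,dx+\frac\gamma\varepsilon\int_{\tilde\Omega}\psi_0'(\varphi)(\vartheta-\varphi)\,dx+\sum_{j=1}^l[\partial_j\Psi](\lambda^\varphi_{i_1},\dots,\lambda^\varphi_{i_l})\Big((\nabla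 w_j,\nabla w_j)_{a_\varepsilon'(\varphi)(\vartheta-\varphi)}+(w_j,w_j)_{b_\varepsilon'(\varphi)(\vartheta-\varphi)}-\lambda^\varphi_{i_j}(w_j,w_j)_{c_\varepsilon'(\varphi)(\vartheta-\varphi)}\Big).$$ -/

import Mathlib

open MeasureTheory
open scoped ContDiff

noncomputable section

namespace PhaseField

/-- The ambient Euclidean space of dimension `d`. -/
abbrev Space (d : ℕ) : Type := EuclideanSpace ℝ (Fin d)

variable {d : ℕ}

/-- `f` is of class `C^{1,1}_loc` on the real line. -/
def IsC11Loc (f : ℝ → ℝ) : Prop :=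
  ContDiff ℝ 1 f ∧ LocallyLipschitz (deriv f)

/-- Test functions: smooth functions with compact support contained in `U`. -/
def IsTest (U : Set (Space d)) (η : Space d → ℝ) : Prop :=
  ContDiff ℝ ∞ η ∧ HasCompactSupport η ∧ tsupport η ⊆ U

/-! ### The Sobolev space of the phase fields -/

/-- `u` and `g` are square integrable on `U`, and `g` is the weak gradient of `u` on `U`. -/
def HasWeakGrad (U : Set (Space d)) (u : Space d → ℝ) (g : Space d → Space d) : Prop :=
  MemLp u 2 (volume.restrict U) ∧ MemLp g 2 (volume.restrict U) ∧
    ∀ η : Space d → ℝ, IsTest U η → ∀ v : Space d,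
      ∫ x in U, u x * fderiv ℝ η x v = -∫ x in U, inner ℝ (g x) v * η x

/-- Membership in the Sobolev space `H¹(U)`. -/
def MemH1 (U : Set (Space d)) (u : Space d → ℝ) : Prop :=
  ∃ g : Space d → Space d, HasWeakGrad U u g

open Classical in
/-- The weak gradient on `U` of a function in `H¹(U)` (for open `U` it is unique up to null sets);
it is zero by convention for functions outside of `H¹(U)`. -/
def weakGrad (U : Set (Space d)) (u : Space d → ℝ) : Space d → Space d :=
  if h : MemH1 U u then h.choose else 0

/-! ### The space `H¹₀(Ω)` and the eigenvalue problem -/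

/-- Pairs `(u, g)` with `u ∈ L²(Ω)` and `g ∈ L²(Ω; ℝᵈ)`, with the Hilbert norm
`(‖u‖² + ‖g‖²)^(1/2)`. On the pairs `(u, ∇u)` this is the norm of `H¹(Ω)`. -/
abbrev L2Pair (Ω : Set (Space d)) : Type :=
  WithLp 2 (Lp ℝ 2 (volume.restrict Ω) × Lp (Space d) 2 (volume.restrict Ω))

/-- The space `H¹₀(Ω)`, the closure of the test functions in the norm of `H¹(Ω)`. An element `w` is
represented by the pair of the function `w.fst` and its weak gradient `w.snd`; the gradient being
determined by the function, nothing is added by carrying it along. -/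
def H10 (Ω : Set (Space d)) : Submodule ℝ (L2Pair Ω) :=
  (Submodule.span ℝ
    {w : L2Pair Ω | ∃ η : Space d → ℝ, IsTest Ω η ∧
      w.fst =ᵐ[volume.restrict Ω] η ∧
      w.snd =ᵐ[volume.restrict Ω] fun x => gradient η x}).topologicalClosure

/-- The weighted bilinear form `(u, v)_f = ∫_Ω f u · v dx`, for scalar or vector valued `u, v`. -/
def wform {F : Type*} [NormedAddCommGroup F] [InnerProductSpace ℝ F]
    (Ω : Set (Space d)) (f : Space d → ℝ) (u v : Space d → F) : ℝ :=
  ∫ x in Ω, f x * inner ℝ (u x) (v x)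

/-- `w ∈ H¹₀(Ω)` is a weak solution of `-∇·(a(φ)∇w) + b(φ) w = ν c(φ) w` in `Ω`, `w = 0` on `∂Ω`. -/
def IsWeakSol (Ω : Set (Space d)) (a b c : ℝ → ℝ) (φ : Space d → ℝ) (ν : ℝ) (w : L2Pair Ω) :
    Prop :=
  w ∈ H10 Ω ∧ ∀ η ∈ H10 Ω,
    wform Ω (fun x => a (φ x)) w.snd η.snd + wform Ω (fun x => b (φ x)) w.fst η.fst
      = ν * wform Ω (fun x => c (φ x)) w.fst η.fst

/-- `w` is an eigenfunction to the Dirichlet eigenvalue `ν`. -/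
def IsEigenfunction (Ω : Set (Space d)) (a b c : ℝ → ℝ) (φ : Space d → ℝ) (ν : ℝ)
    (w : L2Pair Ω) : Prop :=
  w ≠ 0 ∧ IsWeakSol Ω a b c φ ν w

/-- The linear space spanned by all eigenfunctions to eigenvalues `ν ≤ t`. Its dimension is the
number of eigenvalues `≤ t`, counted with multiplicity. -/
def spectralSpace (Ω : Set (Space d)) (a b c : ℝ → ℝ) (φ : Space d → ℝ) (t : ℝ) :
    Submodule ℝ (L2Pair Ω) :=
  Submodule.span ℝ {w | ∃ ν ≤ t, IsEigenfunction Ω a b c φ ν w}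

/-- The `k`-th Dirichlet eigenvalue (`k = 1, 2, …`), where the eigenvalues are listed in
nondecreasing order and repeated according to their multiplicity: the smallest `t` such that there
are at least `k` eigenvalues `≤ t`. -/
def eigenvalue (Ω : Set (Space d)) (a b c : ℝ → ℝ) (φ : Space d → ℝ) (k : ℕ) : ℝ :=
  sInf {t : ℝ | (k : Cardinal) ≤ Module.rank ℝ (spectralSpace Ω a b c φ t)}

/-- The eigenspace to `ν`. (For bounded measurable `φ` and continuous `a, b, c` the eigenfunctions
together with `0` already form a linear space.) -/
def eigenspace (Ω : Set (Space d)) (a b c : ℝ → ℝ) (φ : Space d → ℝ) (ν : ℝ) :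
    Submodule ℝ (L2Pair Ω) :=
  Submodule.span ℝ {w | IsEigenfunction Ω a b c φ ν w}

/-- The number `ν` is a simple eigenvalue: its eigenspace is one-dimensional. -/
def IsSimpleEigenvalue (Ω : Set (Space d)) (a b c : ℝ → ℝ) (φ : Space d → ℝ) (ν : ℝ) : Prop :=
  Module.finrank ℝ (eigenspace Ω a b c φ ν) = 1

/-- `w` is an eigenfunction to `ν` that is normalized by `∫_Ω c(φ) w² dx = 1`. -/
def IsNormalizedEigenfunction (Ω : Set (Space d)) (a b c : ℝ → ℝ) (φ : Space d → ℝ) (ν : ℝ)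
    (w : L2Pair Ω) : Prop :=
  IsEigenfunction Ω a b c φ ν w ∧ wform Ω (fun x => c (φ x)) w.fst w.fst = 1

/-! ### The optimization problem -/

/-- The part `Ω̃ = Ω \ (S₀ ∪ S₁)` of the design domain in which the phase field is free. -/
def freePart (Ω S₀ S₁ : Set (Space d)) : Set (Space d) := Ω \ (S₀ ∪ S₁)

/-- The set `𝒰` of integrable phase fields with prescribed values on `S₀` and `S₁`. -/
def MemU (Ω S₀ S₁ : Set (Space d)) (φ : Space d → ℝ) : Prop :=
  IntegrableOn φ Ω ∧ (∀ᵐ x ∂(volume.restrict S₀), φ x = -1) ∧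
    (∀ᵐ x ∂(volume.restrict S₁), φ x = 1)

/-- The set `𝒢^β` of phase fields in `H¹(V)`, `V = Ω̃`, with `|φ| ≤ 1` and mean value between `β₁`
and `β₂`. -/
def MemG (V : Set (Space d)) (β₁ β₂ : ℝ) (φ : Space d → ℝ) : Prop :=
  MemH1 V φ ∧ (∀ᵐ x ∂(volume.restrict V), |φ x| ≤ 1) ∧
    β₁ * volume.real V ≤ ∫ x in V, φ x ∧ ∫ x in V, φ x ≤ β₂ * volume.real V

/-- The admissible phase fields `𝒢^β ∩ 𝒰`. -/
def Admissible (Ω S₀ S₁ : Set (Space d)) (β₁ β₂ : ℝ) (φ : Space d → ℝ) : Prop :=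
  MemG (freePart Ω S₀ S₁) β₁ β₂ φ ∧ MemU Ω S₀ S₁ φ

/-- The regular part of the Ginzburg--Landau energy on `V = Ω̃`. -/
def energy (V : Set (Space d)) (ψ₀ : ℝ → ℝ) (ε : ℝ) (φ : Space d → ℝ) : ℝ :=
  ∫ x in V, (ε / 2 * ‖weakGrad V φ x‖ ^ 2 + 1 / ε * ψ₀ (φ x))

/-- The vector of the selected eigenvalues `(λ_{i₁}, …, λ_{i_l})`. -/
def eigenvalueVector (Ω : Set (Space d)) (a b c : ℝ → ℝ) {l : ℕ} (i : Fin l → ℕ)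
    (φ : Space d → ℝ) : Fin l → ℝ :=
  fun j => eigenvalue Ω a b c φ (i j)

/-- The objective functional `Ψ(λ_{i₁}, …, λ_{i_l}) + γ E^ε(φ)`. -/
def objective (Ω S₀ S₁ : Set (Space d)) (a b c ψ₀ : ℝ → ℝ) (ε γ : ℝ) {l : ℕ} (i : Fin l → ℕ)
    (Ψ : (Fin l → ℝ) → ℝ) (φ : Space d → ℝ) : ℝ :=
  Ψ (eigenvalueVector Ω a b c i φ) + γ * energy (freePart Ω S₀ S₁) ψ₀ ε φ

/-- `φ` is a minimizer of the optimization problem that is local with respect to the norm of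
`L^∞(Ω)`. -/
def IsLocalMinimizer (Ω S₀ S₁ : Set (Space d)) (β₁ β₂ : ℝ) (a b c ψ₀ : ℝ → ℝ) (ε γ : ℝ) {l : ℕ}
    (i : Fin l → ℕ) (Ψ : (Fin l → ℝ) → ℝ) (φ : Space d → ℝ) : Prop :=
  Admissible Ω S₀ S₁ β₁ β₂ φ ∧
    ∃ δ : ℝ, 0 < δ ∧ ∀ ϑ : Space d → ℝ, Admissible Ω S₀ S₁ β₁ β₂ ϑ →
      eLpNorm (ϑ - φ) ⊤ (volume.restrict Ω) < ENNReal.ofReal δ →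
        objective Ω S₀ S₁ a b c ψ₀ ε γ i Ψ φ ≤ objective Ω S₀ S₁ a b c ψ₀ ε γ i Ψ ϑ

end PhaseField

end

/-! The admissible phase fields form a convex set, so for admissible `ϑ` the objective can be
compared along the segment `φ + t (ϑ - φ)`, `0 ≤ t ≤ 1`. All these fields are bounded by 1, hence
the point at `t` is within `2t` of `φ` in `L^∞` and local minimality applies for small `t`. The
variational inequality says that the right derivative of the objective at `t = 0` is nonnegative.
The energy is quadratic in the gradient plus a `C^{1,1}` term, so its expansion is elementary
(`exists_energy_expansion`). The substance is that a simple eigenvalue has the expected derivative.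

This is proved without differentiating eigenfunctions, for a pencil `(A, C)` of bounded symmetric
forms on a Hilbert space. Maximizing the Rayleigh quotient on the complement of a spectral space
gives `lt_of_orthogonal`, and from it the two halves of the min-max principle, `eigenvalue_le` and
`le_eigenvalue`. A simple eigenvalue has a gap on either side (`exists_gap`). For forms with
expansion `A t = A 0 + t A' + O(t²)`, and likewise for `C`, the unperturbed spectral spaces serve as
trial spaces at parameter `t`. Splitting a vector as `r w + v`, the first order terms in the `w`
direction cancel, the cross terms are `O(t)`, and the gap makes the form definite in `v`. Young's
inequality then leaves an error `O(t²)` in both bounds (`exists_eigenvalue_expansion`).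

The Dirichlet problem fits this scheme on `H¹₀(Ω)`: coercivity is the Poincaré inequality, and
compactness of the embedding in `L²` enters as a bound of the `L²` norm by a small multiple of the
gradient plus finitely many functionals. Both follow from one translation estimate for test
functions, extended by density, so the boundary of `Ω` needs no regularity. Boundedness of the phase
fields and the `C^{1,1}` coefficients give the `O(t²)` remainders of the forms. -/

noncomputable section

namespace PhaseField

/-! ### Pencils of forms: orthogonality and finite dimension of the spectral spaces. -/

section Pencil

variable {H : Type*} [NormedAddCommGroup H] [InnerProductSpace ℝ H]

/-- A pair of symmetric bounded bilinear forms on a Hilbert space, the first one coercive, the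
second one nonnegative and compact. -/
structure IsPencil (A C : H →L[ℝ] H →L[ℝ] ℝ) : Prop where
  symmA : ∀ x y, A x y = A y x
  symmC : ∀ x y, C x y = C y x
  coercive : IsCoercive A
  nonneg : ∀ x, 0 ≤ C x x
  compact : ∀ δ : ℝ, 0 < δ → ∃ (n : ℕ) (S : H →L[ℝ] (Fin n → ℝ)) (K : ℝ),
    ∀ x, C x x ≤ δ * ‖x‖ ^ 2 + K * ‖S x‖ ^ 2

/-- `w` is an eigenvector of the pencil `(A, C)` to the eigenvalue `ν`. -/
def IsEigenvector (A C : H →L[ℝ] H →L[ℝ] ℝ) (ν : ℝ) (w : H) : Prop :=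
  w ≠ 0 ∧ ∀ η, A w η = ν * C w η

/-- The span of all eigenvectors to eigenvalues up to `s`. -/
def pencilSpace (A C : H →L[ℝ] H →L[ℝ] ℝ) (s : ℝ) : Submodule ℝ H :=
  Submodule.span ℝ {w | ∃ ν ≤ s, IsEigenvector A C ν w}

/-- The `k`-th eigenvalue of the pencil `(A, C)`. -/
def pencilEigenvalue (A C : H →L[ℝ] H →L[ℝ] ℝ) (k : ℕ) : ℝ :=
  sInf {t : ℝ | (k : Cardinal) ≤ Module.rank ℝ (pencilSpace A C t)}

variable {A C : H →L[ℝ] H →L[ℝ] ℝ}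

namespace IsPencil

lemma exists_coercive (h : IsPencil A C) : ∃ α > 0, ∀ x, α * ‖x‖ ^ 2 ≤ A x x := by
  obtain ⟨α, hα, h⟩ := h.coercive
  exact ⟨α, hα, fun x => by have := h x; rwa [mul_assoc, ← sq] at this⟩

lemma pos (h : IsPencil A C) {x : H} (hx : x ≠ 0) : 0 < A x x := by
  obtain ⟨α, hα, h⟩ := h.exists_coercive
  exact lt_of_lt_of_le (by have := norm_pos_iff.2 hx; positivity) (h x)

lemma eigenvalue_pos (h : IsPencil A C) {ν : ℝ} {w : H} (hw : IsEigenvector A C ν w) : 0 < ν := by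
  have h1 := h.pos hw.1
  rw [hw.2] at h1
  by_contra hν
  nlinarith [h.nonneg w]

lemma C_pos_of_eigenvector (h : IsPencil A C) {ν : ℝ} {w : H} (hw : IsEigenvector A C ν w) :
    0 < C w w := by
  have h1 := h.pos hw.1
  rw [hw.2] at h1
  exact pos_of_mul_pos_right h1 (h.eigenvalue_pos hw).le

lemma orthogonal (h : IsPencil A C) {ν μ : ℝ} {w u : H} (hw : IsEigenvector A C ν w)
    (hu : IsEigenvector A C μ u) (hne : ν ≠ μ) : C w u = 0 := by
  have h1 := hw.2 u
  have h2 := hu.2 w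
  rw [h.symmA, h.symmC] at h2
  have : (ν - μ) * C w u = 0 := by linarith
  exact (mul_eq_zero.1 this).resolve_left (sub_ne_zero.2 hne)

/-- Eigenvectors to different eigenvalues are `C`-orthogonal. Hence for `v = ∑ fᵢ gᵢ` the difference
`s C(v,v) - A(v,v)` equals `C(u,u)` with `u = ∑ fᵢ √(s - νᵢ) gᵢ`, which is nonnegative. Repeated
eigenvalues do no harm, since the weights agree on them. -/
lemma le_of_mem_pencilSpace (h : IsPencil A C) {s : ℝ} {v : H} (hv : v ∈ pencilSpace A C s) :
    A v v ≤ s * C v v := by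
  obtain ⟨n, f, g, rfl⟩ := Submodule.mem_span_set'.1 hv
  choose ν hν hg using fun i => (g i).2
  set u : H := ∑ i, (f i * √(s - ν i)) • (g i : H) with hu
  have key : s * C (∑ i, f i • (g i : H)) (∑ i, f i • (g i : H))
      - A (∑ i, f i • (g i : H)) (∑ i, f i • (g i : H)) = C u u := by
    simp only [hu, map_sum, map_smul, sum_apply, smul_apply,
      smul_eq_mul, Finset.mul_sum, ← Finset.sum_sub_distrib]
    refine Finset.sum_congr rfl fun i _ => Finset.sum_congr rfl fun j _ => ?_
    rw [(hg j).2]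
    by_cases hij : ν j = ν i
    · have := Real.mul_self_sqrt (sub_nonneg.2 (hν i))
      rw [hij]
      linear_combination (- (f i * f j * C (g j) (g i))) * this
    · rw [h.orthogonal (hg j) (hg i) hij]
      ring
  linarith [h.nonneg u]

/-- On the spectral space `A ≤ s C`, so coercivity bounds the norm by `C`. With a small enough `δ`
in the compactness condition, a vector in the kernel of `S` must vanish: `S` embeds the space into
some `ℝⁿ`. -/
lemma finiteDimensional_pencilSpace (h : IsPencil A C) (s : ℝ) :
    FiniteDimensional ℝ (pencilSpace A C s) := by
  obtain ⟨α, hα, hcoe⟩ := h.exists_coercive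
  obtain ⟨n, S, K, hS⟩ := h.compact (α / (2 * (|s| + 1))) (by positivity)
  refine FiniteDimensional.of_injective (S.toLinearMap.comp (pencilSpace A C s).subtype) ?_
  rw [← LinearMap.ker_eq_bot, LinearMap.ker_eq_bot']
  rintro ⟨x, hx⟩ h0
  have h0 : S x = 0 := h0
  have h1 := h.le_of_mem_pencilSpace hx
  have h2 := hS x
  rw [h0, norm_zero] at h2
  have h3 := hcoe x
  have h4 : s * C x x ≤ (|s| + 1) * C x x :=
    mul_le_mul_of_nonneg_right (by linarith [le_abs_self s]) (h.nonneg x)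
  have h5 : (|s| + 1) * C x x ≤ (|s| + 1) * (α / (2 * (|s| + 1)) * ‖x‖ ^ 2) :=
    mul_le_mul_of_nonneg_left (by linarith) (by positivity)
  have h6 : (|s| + 1) * (α / (2 * (|s| + 1)) * ‖x‖ ^ 2) = α / 2 * ‖x‖ ^ 2 := by
    field_simp
  have h7 : α / 2 * ‖x‖ ^ 2 ≤ 0 := by linarith
  have h8 : ‖x‖ ^ 2 = 0 := by nlinarith [sq_nonneg ‖x‖]
  simpa using h8

end IsPencil

lemma pencilSpace_mono {s t : ℝ} (hst : s ≤ t) : pencilSpace A C s ≤ pencilSpace A C t :=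
  Submodule.span_mono fun _ ⟨ν, hν, hw⟩ => ⟨ν, hν.trans hst, hw⟩

lemma IsEigenvector.mem_pencilSpace {ν s : ℝ} {w : H} (hw : IsEigenvector A C ν w) (h : ν ≤ s) :
    w ∈ pencilSpace A C s := Submodule.subset_span ⟨ν, h, hw⟩

lemma forall_mem_pencilSpace_of_eigenvector {s : ℝ} {f : H →L[ℝ] ℝ}
    (hf : ∀ ν ≤ s, ∀ w, IsEigenvector A C ν w → f w = 0) : ∀ u ∈ pencilSpace A C s, f u = 0 := by
  intro u hu
  have : pencilSpace A C s ≤ LinearMap.ker f.toLinearMap :=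
    Submodule.span_le.2 fun w ⟨ν, hν, hw⟩ => hf ν hν w hw
  exact this hu

/-- A subspace contains a nonzero vector that is orthogonal to a given subspace of smaller
dimension. -/
lemma exists_mem_ne_zero_orthogonal (B : H →L[ℝ] H →L[ℝ] ℝ) {V W : Submodule ℝ H}
    [FiniteDimensional ℝ V] [FiniteDimensional ℝ W]
    (h : Module.finrank ℝ W < Module.finrank ℝ V) :
    ∃ x ∈ V, x ≠ 0 ∧ ∀ u ∈ W, B x u = 0 := by
  -- The pairing with `W` maps `V` to a space of smaller dimension, so it has a kernel.
  let f : V →ₗ[ℝ] Module.Dual ℝ W :=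
    { toFun := fun x => (B x).toLinearMap.comp W.subtype
      map_add' := fun x y => by ext; simp
      map_smul' := fun r x => by ext; simp }
  have hf : LinearMap.ker f ≠ ⊥ :=
    LinearMap.ker_ne_bot_of_finrank_lt (by rwa [Subspace.dual_finrank_eq])
  obtain ⟨x, hx, hx0⟩ := Submodule.exists_mem_ne_zero_of_ne_bot hf
  exact ⟨x, x.2, by simpa using hx0, fun u hu => LinearMap.congr_fun hx ⟨u, hu⟩⟩

end Pencil

/-! ### Existence of eigenvectors by maximizing the Rayleigh quotient. -/

section Pencil

open Filter Topology

variable {H : Type*} [NormedAddCommGroup H] [InnerProductSpace ℝ H]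
variable {A C : H →L[ℝ] H →L[ℝ] ℝ}

namespace IsPencil

lemma C_sq_le (h : IsPencil A C) (x y : H) : C x y ^ 2 ≤ C x x * C y y := by
  have key : ∀ t : ℝ, 0 ≤ C y y * (t * t) + (2 * C x y) * t + C x x := fun t => by
    have := h.nonneg (x + t • y)
    simp only [map_add, map_smul, add_apply, smul_apply, smul_eq_mul, h.symmC y x] at this
    linarith
  have := discrim_le_zero key
  rw [discrim] at this
  linarith

variable [CompleteSpace H]

/-- Lax–Milgram. The operator `T` turns the pencil into an ordinary eigenvalue problem, with `T w =
m w` corresponding to the eigenvalue `1 / m`. -/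
lemma exists_representation (h : IsPencil A C) : ∃ T : H →L[ℝ] H, ∀ u v, A (T u) v = C u v := by
  refine ⟨(h.coercive.continuousLinearEquivOfBilin.symm : H →L[ℝ] H).comp
    (InnerProductSpace.continuousLinearMapOfBilin C), fun u v => ?_⟩
  rw [← h.coercive.continuousLinearEquivOfBilin_apply]
  simp

/-- The maximum of the Rayleigh quotient on an invariant closed subspace is attained at an
eigenvector. -/
lemma exists_maximizer (h : IsPencil A C) {T : H →L[ℝ] H} (hT : ∀ u v, A (T u) v = C u v)
    {X : Submodule ℝ H} (hX : IsClosed (X : Set H)) (hTX : ∀ x ∈ X, T x ∈ X) {x₀ : H}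
    (hx₀ : x₀ ∈ X) (hpos : 0 < C x₀ x₀) :
    ∃ m > 0, ∃ w ∈ X, w ≠ 0 ∧ T w = m • w ∧ ∀ v ∈ X, C v v ≤ m * A v v := by
  obtain ⟨α, hα, hcoe⟩ := h.exists_coercive
  set R : Set ℝ := {r | ∃ v ∈ X, A v v = 1 ∧ C v v = r} with hR
  have hnorm : ∀ v, A v v = 1 → ‖v‖ ^ 2 ≤ 1 / α := fun v hv => by
    rw [le_div_iff₀ hα]
    linarith [hcoe v]
  have hbdd : BddAbove R := by
    refine ⟨‖C‖ * (1 / α), ?_⟩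
    rintro r ⟨v, -, hv, rfl⟩
    calc C v v ≤ ‖C v v‖ := Real.le_norm_self _
      _ ≤ ‖C‖ * ‖v‖ * ‖v‖ := C.le_opNorm₂ v v
      _ = ‖C‖ * ‖v‖ ^ 2 := by ring
      _ ≤ _ := mul_le_mul_of_nonneg_left (hnorm v hv) C.opNorm_nonneg
  have hscale : ∀ v ∈ X, v ≠ 0 → C v v / A v v ∈ R := fun v hv hv0 => by
    have hA := h.pos hv0
    have hs : √(A v v) * √(A v v) = A v v := Real.mul_self_sqrt hA.le
    have hs0 : √(A v v) ≠ 0 := (Real.sqrt_pos.2 hA).ne'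
    refine ⟨(√(A v v))⁻¹ • v, X.smul_mem _ hv, ?_, ?_⟩
    · simp only [map_smul, smul_apply, smul_eq_mul]
      field_simp
      linarith
    · simp only [map_smul, smul_apply, smul_eq_mul]
      rw [← mul_assoc, ← mul_inv, hs, div_eq_inv_mul]
  have hx₀0 : x₀ ≠ 0 := by
    rintro rfl
    simp at hpos
  set m := sSup R with hm
  have hm0 : 0 < m :=
    lt_of_lt_of_le (div_pos hpos (h.pos hx₀0)) (le_csSup hbdd (hscale x₀ hx₀ hx₀0))
  have hmax : ∀ v ∈ X, C v v ≤ m * A v v := fun v hv => by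
    by_cases hv0 : v = 0
    · simp [hv0]
    · rw [← div_le_iff₀ (h.pos hv0)]
      exact le_csSup hbdd (hscale v hv hv0)
  -- Cauchy–Schwarz for `C` with `C(v, Tv) = A(Tv, Tv)` gives `A(Tv,Tv)² ≤ C(v,v) C(Tv,Tv)`, and the
  -- last factor is at most `m A(Tv,Tv)` because `Tv` lies in `X`.
  have hTT : ∀ v ∈ X, A (T v) (T v) ≤ m * C v v := fun v hv => by
    have h1 := h.C_sq_le v (T v)
    rw [← hT v (T v)] at h1
    have h2 := hmax _ (hTX v hv)
    by_contra hlt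
    push Not at hlt
    have h3 : 0 < A (T v) (T v) := lt_of_le_of_lt (mul_nonneg hm0.le (h.nonneg v)) hlt
    have h4 : C v v * C (T v) (T v) ≤ C v v * (m * A (T v) (T v)) :=
      mul_le_mul_of_nonneg_left h2 (h.nonneg v)
    nlinarith
  obtain ⟨r, -, hrm, hrR⟩ := exists_seq_tendsto_sSup ⟨_, hscale x₀ hx₀ hx₀0⟩ hbdd
  choose x hxX hx1 hxr using hrR
  -- A maximizing sequence is almost an eigenvector: with `A(x,x) = 1` and `C(x,x) = r`, the
  -- `A`-square of `Tx - m x` is `A(Tx,Tx) - 2 m r + m² ≤ m (m - r)`.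
  have hrem : Tendsto (fun n => T (x n) - m • x n) atTop (𝓝 0) := by
    rw [tendsto_zero_iff_norm_tendsto_zero]
    have hlim : Tendsto (fun n => √(m * (m - r n) / α)) atTop (𝓝 0) := by
      have : Tendsto (fun n => √(m * (m - r n) / α)) atTop (𝓝 √(m * (m - m) / α)) :=
        (((tendsto_const_nhds.sub hrm).const_mul m).div_const α).sqrt
      simpa using this
    refine squeeze_zero (fun n => norm_nonneg _) (fun n => ?_) hlim
    refine Real.le_sqrt_of_sq_le ?_
    rw [le_div_iff₀ hα]
    have h1 := hcoe (T (x n) - m • x n)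
    have h2 := hTT _ (hxX n)
    have h3 := hT (x n) (x n)
    have h4 := h.symmA (x n) (T (x n))
    have h5 := hx1 n
    simp only [map_sub, map_smul, sub_apply, smul_apply, smul_eq_mul] at h1
    rw [h4, h3, h5, hxr] at h1
    rw [hxr] at h2
    nlinarith
  -- The constant is small enough for the term in `‖y‖²` to be absorbed on the left in `h7`.
  obtain ⟨N, S, K, hS⟩ := h.compact (α * m / 8) (by positivity)
  set L : ℝ := 4 * (|K| / α / m) + 4 / m ^ 2 with hL
  have hL0 : 0 ≤ L := by positivity
  -- On `X` a vector is controlled by the pair `(S y, T y - m y)`. Along the maximizing sequence the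
  -- first entry is bounded in finite dimension and the second tends to zero, so a subsequence of
  -- pairs converges and the vectors themselves are Cauchy.
  have hest : ∀ y ∈ X, ‖y‖ ^ 2 ≤ L * ‖(S y, T y - m • y)‖ ^ 2 := fun y hy => by
    have h1 : ‖S y‖ ^ 2 ≤ ‖(S y, T y - m • y)‖ ^ 2 := by
      gcongr
      exact norm_fst_le (S y, T y - m • y)
    have h2 : ‖T y - m • y‖ ^ 2 ≤ ‖(S y, T y - m • y)‖ ^ 2 := by
      gcongr
      exact norm_snd_le (S y, T y - m • y)
    have h3 : m * ‖y‖ ≤ ‖T y‖ + ‖T y - m • y‖ := by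
      have := norm_sub_le (T y) (T y - m • y)
      rwa [sub_sub_cancel, norm_smul, Real.norm_of_nonneg hm0.le] at this
    have h4 : m ^ 2 * ‖y‖ ^ 2 ≤ 2 * ‖T y‖ ^ 2 + 2 * ‖T y - m • y‖ ^ 2 := by
      have : (m * ‖y‖) ^ 2 ≤ (‖T y‖ + ‖T y - m • y‖) ^ 2 := by gcongr
      nlinarith [sq_nonneg (‖T y‖ - ‖T y - m • y‖)]
    have h5 : α * ‖T y‖ ^ 2 ≤ m * (α * m / 8 * ‖y‖ ^ 2 + |K| * ‖S y‖ ^ 2) :=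
      (hcoe _).trans ((hTT y hy).trans (mul_le_mul_of_nonneg_left ((hS y).trans (by
        gcongr
        exact le_abs_self K)) hm0.le))
    have h6 : ‖T y‖ ^ 2 ≤ m ^ 2 / 8 * ‖y‖ ^ 2 + m * (|K| / α) * ‖S y‖ ^ 2 := by
      rw [← mul_le_mul_iff_right₀ hα]
      refine h5.trans (le_of_eq ?_)
      field_simp
    have h7 : m ^ 2 * ‖y‖ ^ 2 ≤ 4 * (m * (|K| / α)) * ‖S y‖ ^ 2 + 4 * ‖T y - m • y‖ ^ 2 := by
      nlinarith [sq_nonneg (m * ‖y‖)]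
    have h8 : m ^ 2 * ‖y‖ ^ 2 ≤ (4 * (m * (|K| / α)) + 4) * ‖(S y, T y - m • y)‖ ^ 2 := by
      have : 4 * (m * (|K| / α)) * ‖S y‖ ^ 2
          ≤ 4 * (m * (|K| / α)) * ‖(S y, T y - m • y)‖ ^ 2 := by gcongr
      linarith
    have h9 : m ^ 2 * (L * ‖(S y, T y - m • y)‖ ^ 2)
        = (4 * (m * (|K| / α)) + 4) * ‖(S y, T y - m • y)‖ ^ 2 := by
      rw [hL]
      field_simp
    rw [← h9] at h8
    exact le_of_mul_le_mul_left h8 (by positivity)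
  have hxb : ∀ n, S (x n) ∈ Metric.closedBall (0 : Fin N → ℝ) (‖S‖ * √(1 / α)) := fun n => by
    rw [mem_closedBall_zero_iff]
    exact (S.le_opNorm _).trans (mul_le_mul_of_nonneg_left
      (Real.le_sqrt_of_sq_le (hnorm _ (hx1 n))) (norm_nonneg _))
  obtain ⟨z, -, φ, hφ, hz⟩ := tendsto_subseq_of_bounded Metric.isBounded_closedBall hxb
  have hcauchy : CauchySeq (fun n => x (φ n)) := by
    have hpair : CauchySeq (fun n => (S (x (φ n)), T (x (φ n)) - m • x (φ n))) :=
      (hz.prodMk_nhds (hrem.comp hφ.tendsto_atTop)).cauchySeq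
    rw [cauchySeq_iff_tendsto_dist_atTop_0] at hpair ⊢
    have hlim := hpair.const_mul √L
    rw [mul_zero] at hlim
    refine squeeze_zero (fun _ => dist_nonneg) (fun n => ?_) hlim
    have h1 := hest _ (X.sub_mem (hxX (φ n.1)) (hxX (φ n.2)))
    rw [dist_eq_norm, dist_eq_norm]
    have h2 : ((S (x (φ n.1)), T (x (φ n.1)) - m • x (φ n.1))
        - (S (x (φ n.2)), T (x (φ n.2)) - m • x (φ n.2)))
        = (S (x (φ n.1) - x (φ n.2)),
          T (x (φ n.1) - x (φ n.2)) - m • (x (φ n.1) - x (φ n.2))) := by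
      ext1
      · simp
      · simp only [Prod.snd_sub, map_sub, smul_sub]
        abel
    rw [h2]
    refine abs_le_of_sq_le_sq' ?_ (by positivity) |>.2
    rw [mul_pow, Real.sq_sqrt hL0]
    exact h1
  obtain ⟨w, hw⟩ := cauchySeq_tendsto_of_complete hcauchy
  refine ⟨m, hm0, w, hX.mem_of_tendsto hw (Eventually.of_forall fun n => hxX _), ?_, ?_, hmax⟩
  · rintro rfl
    have hc : Continuous fun v => A v v := by fun_prop
    have h1 : Tendsto (fun n => A (x (φ n)) (x (φ n))) atTop (𝓝 (A 0 0)) :=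
      (hc.tendsto 0).comp hw
    simp only [hx1, map_zero] at h1
    exact one_ne_zero (tendsto_nhds_unique tendsto_const_nhds h1)
  · have hc : Continuous fun v => T v - m • v := by fun_prop
    have h1 := (hc.tendsto w).comp hw
    exact sub_eq_zero.1 (tendsto_nhds_unique h1 (hrem.comp hφ.tendsto_atTop))

/-- On the orthogonal complement of the eigenvectors up to `s` the Rayleigh quotient exceeds `s`. -/
lemma lt_of_orthogonal (h : IsPencil A C) {s : ℝ} {v : H} (hv0 : v ≠ 0)
    (hv : ∀ u ∈ pencilSpace A C s, A v u = 0) : s * C v v < A v v := by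
  by_contra! hle
  obtain ⟨T, hT⟩ := h.exists_representation
  let X : Submodule ℝ H :=
    { carrier := {v | ∀ u ∈ pencilSpace A C s, A v u = 0}
      zero_mem' := fun u _ => by simp
      add_mem' := fun hx hy u hu => by simp [hx u hu, hy u hu]
      smul_mem' := fun c x hx u hu => by simp [hx u hu] }
  have hX : IsClosed (X : Set H) := by
    have : (X : Set H) = ⋂ u ∈ pencilSpace A C s, {v | A v u = 0} := by
      ext v
      simp [X]
    rw [this]
    exact isClosed_biInter fun u _ => isClosed_eq (by fun_prop) continuous_const
  -- For an eigenvector `w`, both `A(x, w)` and `A(Tx, w)` are multiples of `C(x, w)`, the former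
  -- with a nonzero factor.
  have hTX : ∀ x ∈ X, T x ∈ X := fun x hx =>
    forall_mem_pencilSpace_of_eigenvector fun ν hν w hw => by
      have h1 := hx w (hw.mem_pencilSpace hν)
      rw [h.symmA, hw.2, h.symmC] at h1
      rw [hT]
      exact (mul_eq_zero.1 h1).resolve_left (h.eigenvalue_pos hw).ne'
  have hC : 0 < C v v := by
    have := h.pos hv0
    rcases (h.nonneg v).lt_or_eq with h1 | h1
    · exact h1
    · rw [← h1] at hle
      linarith
  obtain ⟨m, hm, w, hwX, hw0, hTw, hmax⟩ := h.exists_maximizer hT hX hTX (x₀ := v) hv hC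
  have hw : IsEigenvector A C (1 / m) w := by
    refine ⟨hw0, fun η => ?_⟩
    rw [← hT, hTw]
    simp only [map_smul, smul_apply, smul_eq_mul]
    field_simp
  -- The vector `v` has Rayleigh quotient at most `s`, so the maximum `m` of `C / A` is at least `1
  -- / s`. Then `w` lies in the spectral space and is also `A`-orthogonal to it, which is absurd.
  have hms : 1 / m ≤ s := by
    rw [div_le_iff₀ hm]
    have h1 := hmax v hv
    by_contra! hlt
    nlinarith
  exact (h.pos hw0).ne' (hwX w (hw.mem_pencilSpace hms))

end IsPencil

end Pencil

/-! ### Min-max bounds, the spectral gap, and perturbation of a simple eigenvalue. -/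

section Pencil

open Filter Topology Set

variable {H : Type*} [NormedAddCommGroup H] [InnerProductSpace ℝ H]

namespace IsPencil

section Gap

variable {A C : H →L[ℝ] H →L[ℝ] ℝ}

lemma nonnegA (h : IsPencil A C) (x : H) : 0 ≤ A x x := by
  obtain ⟨α, hα, h⟩ := h.exists_coercive
  exact le_trans (by positivity) (h x)

lemma le_rank_iff (h : IsPencil A C) {k : ℕ} {s : ℝ} :
    (k : Cardinal) ≤ Module.rank ℝ (pencilSpace A C s)
      ↔ k ≤ Module.finrank ℝ (pencilSpace A C s) := by
  have := h.finiteDimensional_pencilSpace s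
  rw [← Module.finrank_eq_rank, Nat.cast_le]

lemma pos_of_le_finrank (h : IsPencil A C) {k : ℕ} (hk : 1 ≤ k) {s : ℝ}
    (hs : k ≤ Module.finrank ℝ (pencilSpace A C s)) : 0 < s := by
  have := h.finiteDimensional_pencilSpace s
  have hne : pencilSpace A C s ≠ ⊥ := fun h0 => by
    rw [h0, finrank_bot] at hs
    omega
  obtain ⟨v, hv, hv0⟩ := Submodule.exists_mem_ne_zero_of_ne_bot hne
  have h1 := h.le_of_mem_pencilSpace hv
  have h2 := h.pos hv0
  by_contra! hs0
  nlinarith [h.nonneg v]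

/-- Makes the infimum in `pencilEigenvalue` a genuine one. For `k = 0` the set would be all of `ℝ`.
-/
lemma bddBelow (h : IsPencil A C) {k : ℕ} (hk : 1 ≤ k) :
    BddBelow {t : ℝ | (k : Cardinal) ≤ Module.rank ℝ (pencilSpace A C t)} :=
  ⟨0, fun _ ht => (h.pos_of_le_finrank hk (h.le_rank_iff.1 ht)).le⟩

lemma finrank_lt_of_lt (h : IsPencil A C) {k : ℕ} (hk : 1 ≤ k) {s : ℝ}
    (hs : s < pencilEigenvalue A C k) : Module.finrank ℝ (pencilSpace A C s) < k := by
  by_contra! hle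
  exact hs.not_ge (csInf_le (h.bddBelow hk) (h.le_rank_iff.2 hle))

/-- Upper half of min-max: if the spectral space had dimension below `k`, some nonzero vector of `V`
would be `A`-orthogonal to it, contradicting `lt_of_orthogonal`. The dimension bound is returned as
well because `le_eigenvalue` needs it to rule out the infimum of an empty set. -/
lemma eigenvalue_le [CompleteSpace H] (h : IsPencil A C) {k : ℕ} (hk : 1 ≤ k) {s : ℝ}
    {V : Submodule ℝ H} [FiniteDimensional ℝ V] (hV : k ≤ Module.finrank ℝ V)
    (hVs : ∀ x ∈ V, A x x ≤ s * C x x) :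
    k ≤ Module.finrank ℝ (pencilSpace A C s) ∧ pencilEigenvalue A C k ≤ s := by
  have := h.finiteDimensional_pencilSpace s
  have key : k ≤ Module.finrank ℝ (pencilSpace A C s) := by
    by_contra! hlt
    obtain ⟨x, hxV, hx0, hx⟩ := exists_mem_ne_zero_orthogonal A (hlt.trans_le hV)
    exact (h.lt_of_orthogonal hx0 hx).not_ge (hVs x hxV)
  exact ⟨key, csInf_le (h.bddBelow hk) (h.le_rank_iff.2 key)⟩

/-- Lower half of min-max: every spectral space of dimension at least `k` contains a nonzero vector
orthogonal to `W`. Orthogonality may be taken in any form `B`, so the unperturbed form can be used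
for the perturbed pencil. -/
lemma le_eigenvalue (h : IsPencil A C) (B : H →L[ℝ] H →L[ℝ] ℝ) {k : ℕ} {s : ℝ}
    (hne : ∃ t, k ≤ Module.finrank ℝ (pencilSpace A C t))
    {W : Submodule ℝ H} [FiniteDimensional ℝ W] (hW : Module.finrank ℝ W < k)
    (hWs : ∀ x, (∀ u ∈ W, B x u = 0) → s * C x x ≤ A x x) :
    s ≤ pencilEigenvalue A C k := by
  obtain ⟨t₀, ht₀⟩ := hne
  refine le_csInf ⟨t₀, h.le_rank_iff.2 ht₀⟩ fun t ht => ?_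
  have := h.finiteDimensional_pencilSpace t
  obtain ⟨x, hxV, hx0, hx⟩ :=
    exists_mem_ne_zero_orthogonal B (hW.trans_le (h.le_rank_iff.1 ht))
  have h1 := hWs x hx
  have h2 := h.le_of_mem_pencilSpace hxV
  have h3 := h.pos hx0
  have h4 : 0 < C x x := by
    rcases (h.nonneg x).lt_or_eq with h5 | h5
    · exact h5
    · rw [← h5] at h2
      linarith
  exact le_of_mul_le_mul_right (h1.trans h2) h4

/-- A simple eigenvalue is isolated. -/
lemma exists_gap (h : IsPencil A C) {k : ℕ} (hk : 1 ≤ k) {ev : ℝ}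
    (hev : ev = pencilEigenvalue A C k) {w : H} (hw : IsEigenvector A C ev w)
    (hsimple : ∀ v, IsEigenvector A C ev v → v ∈ Submodule.span ℝ {w}) :
    ∃ s₁ s₀, 0 < s₁ ∧ s₁ < ev ∧ ev < s₀ ∧ Module.finrank ℝ (pencilSpace A C s₁) < k ∧
      k ≤ Module.finrank ℝ (pencilSpace A C s₀) ∧
      pencilSpace A C s₀ ≤ pencilSpace A C s₁ ⊔ Submodule.span ℝ {w} := by
  have hev0 := h.eigenvalue_pos hw
  have hfd := h.finiteDimensional_pencilSpace
  -- The dimension of the spectral space is a monotone integer function of the level. At `s₀` it is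
  -- minimal among levels above `ev`, at `s₁` maximal among levels in `(0, ev)`. Hence no eigenvalue
  -- lies in `(s₁, ev)` or `(ev, s₀]`. Below `ev` the dimension is less than `k`, so the truncated
  -- difference `k - finrank` loses nothing.
  obtain ⟨s₀, hs₀, hmin⟩ := (measure fun s => Module.finrank ℝ (pencilSpace A C s)).wf.has_min
    (Ioi ev) ⟨ev + 1, by simp⟩
  obtain ⟨s₁, hs₁, hmax⟩ :=
    (measure fun s => k - Module.finrank ℝ (pencilSpace A C s)).wf.has_min
    (Ioo 0 ev) ⟨ev / 2, by constructor <;> linarith⟩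
  have hlt : ∀ s < ev, Module.finrank ℝ (pencilSpace A C s) < k := fun s hs =>
    h.finrank_lt_of_lt hk (hev ▸ hs)
  have hge : ∀ s > ev, k ≤ Module.finrank ℝ (pencilSpace A C s) := fun s hs => by
    have hne : {t : ℝ | (k : Cardinal) ≤ Module.rank ℝ (pencilSpace A C t)}.Nonempty := by
      rw [nonempty_iff_ne_empty]
      intro h0
      rw [hev, pencilEigenvalue, h0, Real.sInf_empty] at hev0
      exact lt_irrefl _ hev0
    rw [hev] at hs
    obtain ⟨t, ht, hts⟩ := exists_lt_of_csInf_lt hne hs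
    exact (h.le_rank_iff.1 ht).trans (Submodule.finrank_mono (pencilSpace_mono hts.le))
  refine ⟨s₁, s₀, hs₁.1, hs₁.2, hs₀, hlt _ hs₁.2, hge _ hs₀, Submodule.span_le.2 ?_⟩
  rintro u ⟨ν, hν, hu⟩
  -- An eigenvector to `ν` has Rayleigh quotient `ν`, too large for a lower spectral space; a level
  -- between eigenvalues would thus change the dimension.
  have hcontra : ∀ s < ν, u ∉ pencilSpace A C s := fun s hs hus => by
    have h1 := h.le_of_mem_pencilSpace hus
    rw [hu.2] at h1
    exact hs.not_ge (le_of_mul_le_mul_right h1 (h.C_pos_of_eigenvector hu))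
  rcases lt_trichotomy ν ev with hlt' | heq | hgt
  · refine Submodule.mem_sup_left (hu.mem_pencilSpace ?_)
    by_contra! hs
    have h1 := hmax ν ⟨hs₁.1.trans hs, hlt'⟩
    have h2 := Submodule.finrank_mono (pencilSpace_mono (A := A) (C := C) hs.le)
    have h3 : ¬ (k - Module.finrank ℝ (pencilSpace A C ν)
      < k - Module.finrank ℝ (pencilSpace A C s₁)) := h1
    have h4 := hlt ν hlt'
    have h5 := Submodule.eq_of_le_of_finrank_eq (pencilSpace_mono (A := A) (C := C) hs.le)
      (by omega)
    exact hcontra s₁ hs (h5 ▸ hu.mem_pencilSpace le_rfl)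
  · exact Submodule.mem_sup_right (hsimple u (heq ▸ hu))
  · exfalso
    have hle : (ev + ν) / 2 ≤ s₀ := by linarith
    have h1 : ¬ (Module.finrank ℝ (pencilSpace A C ((ev + ν) / 2))
      < Module.finrank ℝ (pencilSpace A C s₀)) := hmin _ (show ev < (ev + ν) / 2 by linarith)
    have h2 := Submodule.finrank_mono (pencilSpace_mono (A := A) (C := C) hle)
    have h5 := Submodule.eq_of_le_of_finrank_eq (pencilSpace_mono (A := A) (C := C) hle)
      (by omega)
    exact hcontra ((ev + ν) / 2) (by linarith) (h5 ▸ hu.mem_pencilSpace hν)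

end Gap

/-- Young's inequality: half of the gap `g` absorbs the diagonal perturbation, the other half the
cross term, at the price of `2 K₂² / g · t²` in the coefficient of `p²`. -/
lemma quadratic_nonneg {K₁ K₂ g t p q : ℝ} (hg : 0 < g) (ht : K₂ * t ≤ g / 2) :
    0 ≤ p ^ 2 * ((K₁ + 2 * K₂ ^ 2 / g) * t ^ 2 - K₁ * t ^ 2) - 2 * (K₂ * t * p * q)
      + (g * q ^ 2 - K₂ * t * q ^ 2) := by
  have h1 : 0 ≤ 2 / g * (K₂ * (t * p) - g * q / 2) ^ 2 := by positivity
  have h2 : 2 / g * (K₂ * (t * p) - g * q / 2) ^ 2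
      = p ^ 2 * (2 * K₂ ^ 2 / g * t ^ 2) - 2 * (K₂ * t * p * q) + g / 2 * q ^ 2 := by
    field_simp
    ring
  nlinarith [mul_le_mul_of_nonneg_right ht (sq_nonneg q)]

section Perturbation

variable {A C : ℝ → H →L[ℝ] H →L[ℝ] ℝ} {A' C' : H →L[ℝ] H →L[ℝ] ℝ} {K : ℝ}

/-- Bounds for the shifted forms in terms of the size of the perturbation. -/
lemma exists_perturbation_bounds
    (hA : ∀ t ∈ Icc (0 : ℝ) 1, ∀ x y, |A t x y - A 0 x y - t * A' x y| ≤ K * t ^ 2 * (‖x‖ * ‖y‖))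
    (hC : ∀ t ∈ Icc (0 : ℝ) 1, ∀ x y, |C t x y - C 0 x y - t * C' x y| ≤ K * t ^ 2 * (‖x‖ * ‖y‖))
    (hK : 0 ≤ K) {ev : ℝ} {w : H} (hw : A 0 w w = ev) (hw1 : C 0 w w = 1) :
    ∃ K₁ K₂ : ℝ, 0 ≤ K₁ ∧ 0 ≤ K₂ ∧ ∀ t ∈ Icc (0 : ℝ) 1, ∀ ρ : ℝ, |ρ| ≤ t →
      |A t w w - (ev + t * (A' w w - ev * C' w w) + ρ) * C t w w + ρ| ≤ K₁ * t ^ 2 ∧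
      ∀ x y, |A t x y - (ev + t * (A' w w - ev * C' w w) + ρ) * C t x y
        - (A 0 x y - ev * C 0 x y)| ≤ K₂ * t * (‖x‖ * ‖y‖) := by
  set D := A' w w - ev * C' w w with hD
  -- `S` bounds the shift `ev + t D + ρ`. Only `|ρ| ≤ t` is used, so the constants do not depend on
  -- the choice `ρ = ± M t²` made later, where `M` is built from them.
  set S := |ev| + |D| + 1 with hS
  refine ⟨(K + S * K) * (‖w‖ * ‖w‖) + (|D| + 1) * |C' w w|,
    ‖A'‖ + K + S * (‖C'‖ + K) + (|D| + 1) * ‖C 0‖, by positivity, by positivity,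
    fun t ht ρ hρ => ?_⟩
  have ht0 := ht.1
  have ht1 := ht.2
  have hDρ : |t * D + ρ| ≤ t * (|D| + 1) := by
    refine (abs_add_le _ _).trans ?_
    rw [abs_mul, abs_of_nonneg ht0]
    linarith
  have hσ : |ev + t * D + ρ| ≤ S := by
    have h1 : |ev + t * D + ρ| ≤ |ev| + |t * D + ρ| := by
      rw [add_assoc]
      exact abs_add_le _ _
    have h2 : t * (|D| + 1) ≤ 1 * (|D| + 1) := by gcongr
    linarith
  constructor
  · have h1 := hA t ht w w
    have h2 := hC t ht w w
    set rA := A t w w - A 0 w w - t * A' w w with hrA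
    set rC := C t w w - C 0 w w - t * C' w w with hrC
    -- The choice of `D` cancels all terms of first order in `t`.
    have e : A t w w - (ev + t * D + ρ) * C t w w + ρ
        = rA - (ev + t * D + ρ) * rC - t * (t * D + ρ) * C' w w := by
      rw [hrA, hrC, hw, hw1, hD]
      ring
    rw [e]
    have b1 : |(ev + t * D + ρ) * rC| ≤ S * (K * t ^ 2 * (‖w‖ * ‖w‖)) := by
      rw [abs_mul]
      gcongr
    have b2 : |t * (t * D + ρ) * C' w w| ≤ t * (t * (|D| + 1)) * |C' w w| := by
      rw [abs_mul, abs_mul, abs_of_nonneg ht0]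
      gcongr
    calc _ ≤ |rA| + |(ev + t * D + ρ) * rC| + |t * (t * D + ρ) * C' w w| :=
          (abs_sub _ _).trans (add_le_add_left (abs_sub _ _) _)
      _ ≤ K * t ^ 2 * (‖w‖ * ‖w‖) + S * (K * t ^ 2 * (‖w‖ * ‖w‖))
          + t * (t * (|D| + 1)) * |C' w w| := by gcongr
      _ = _ := by ring
  · intro x y
    have h1 := hA t ht x y
    have h2 := hC t ht x y
    set rA := A t x y - A 0 x y - t * A' x y with hrA
    set rC := C t x y - C 0 x y - t * C' x y with hrC
    have e : A t x y - (ev + t * D + ρ) * C t x y - (A 0 x y - ev * C 0 x y)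
        = t * A' x y + rA - (ev + t * D + ρ) * (t * C' x y + rC) - (t * D + ρ) * C 0 x y := by
      rw [hrA, hrC]
      ring
    rw [e]
    have hN : 0 ≤ ‖x‖ * ‖y‖ := by positivity
    have n1 : |A' x y| ≤ ‖A'‖ * (‖x‖ * ‖y‖) := by
      rw [← mul_assoc]
      exact A'.le_opNorm₂ x y
    have n2 : |C' x y| ≤ ‖C'‖ * (‖x‖ * ‖y‖) := by
      rw [← mul_assoc]
      exact C'.le_opNorm₂ x y
    have n3 : |C 0 x y| ≤ ‖C 0‖ * (‖x‖ * ‖y‖) := by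
      rw [← mul_assoc]
      exact (C 0).le_opNorm₂ x y
    have htt : K * t ^ 2 * (‖x‖ * ‖y‖) ≤ K * t * (‖x‖ * ‖y‖) := by
      have : t ^ 2 ≤ t := by nlinarith
      gcongr
    have b1 : |t * A' x y| ≤ t * (‖A'‖ * (‖x‖ * ‖y‖)) := by
      rw [abs_mul, abs_of_nonneg ht0]
      gcongr
    have b2 : |t * C' x y + rC| ≤ t * (‖C'‖ * (‖x‖ * ‖y‖)) + K * t * (‖x‖ * ‖y‖) := by
      refine (abs_add_le _ _).trans ?_
      rw [abs_mul, abs_of_nonneg ht0]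
      have := h2.trans htt
      gcongr
    have b3 : |(ev + t * D + ρ) * (t * C' x y + rC)|
        ≤ S * (t * (‖C'‖ * (‖x‖ * ‖y‖)) + K * t * (‖x‖ * ‖y‖)) := by
      rw [abs_mul]
      gcongr
    have b4 : |(t * D + ρ) * C 0 x y| ≤ t * (|D| + 1) * (‖C 0‖ * (‖x‖ * ‖y‖)) := by
      rw [abs_mul]
      gcongr
    calc _ ≤ |t * A' x y + rA| + |(ev + t * D + ρ) * (t * C' x y + rC)|
            + |(t * D + ρ) * C 0 x y| :=
          (abs_sub _ _).trans (add_le_add_left (abs_sub _ _) _)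
      _ ≤ (t * (‖A'‖ * (‖x‖ * ‖y‖)) + K * t * (‖x‖ * ‖y‖))
          + S * (t * (‖C'‖ * (‖x‖ * ‖y‖)) + K * t * (‖x‖ * ‖y‖))
          + t * (|D| + 1) * (‖C 0‖ * (‖x‖ * ‖y‖)) := by
        gcongr
        exact (abs_add_le _ _).trans (add_le_add b1 (h1.trans htt))
      _ = _ := by ring

/-- First order expansion of a simple eigenvalue. -/
lemma exists_eigenvalue_expansion [CompleteSpace H]
    (hP : ∀ t ∈ Icc (0 : ℝ) 1, IsPencil (A t) (C t))
    (hA : ∀ t ∈ Icc (0 : ℝ) 1, ∀ x y, |A t x y - A 0 x y - t * A' x y| ≤ K * t ^ 2 * (‖x‖ * ‖y‖))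
    (hC : ∀ t ∈ Icc (0 : ℝ) 1, ∀ x y, |C t x y - C 0 x y - t * C' x y| ≤ K * t ^ 2 * (‖x‖ * ‖y‖))
    (hK : 0 ≤ K) {k : ℕ} (hk : 1 ≤ k) {ev : ℝ}
    (hev : ev = pencilEigenvalue (A 0) (C 0) k) {w : H} (hw : IsEigenvector (A 0) (C 0) ev w)
    (hw1 : C 0 w w = 1)
    (hsimple : ∀ v, IsEigenvector (A 0) (C 0) ev v → v ∈ Submodule.span ℝ {w}) :
    ∃ M τ : ℝ, 0 < τ ∧ ∀ t ∈ Icc (0 : ℝ) τ,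
      |pencilEigenvalue (A t) (C t) k - ev - t * (A' w w - ev * C' w w)| ≤ M * t ^ 2 := by
  have h0 : IsPencil (A 0) (C 0) := hP 0 (by simp)
  have hfd := h0.finiteDimensional_pencilSpace
  have hAw : A 0 w w = ev := by rw [hw.2, hw1, mul_one]
  have hev0 := h0.eigenvalue_pos hw
  obtain ⟨α, hα, hcoe⟩ := h0.exists_coercive
  obtain ⟨s₁, s₀, hs₁, hs₁ev, hevs₀, hlt, hge, hsup⟩ := h0.exists_gap hk hev hw hsimple
  obtain ⟨K₁, K₂, hK₁, hK₂, hbd⟩ := exists_perturbation_bounds hA hC hK hAw hw1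
  set D := A' w w - ev * C' w w with hD
  have horth : ∀ u ∈ pencilSpace (A 0) (C 0) s₁, A 0 w u = 0 :=
    forall_mem_pencilSpace_of_eigenvector fun ν hν u hu => by
      rw [hw.2, h0.orthogonal hw hu (by linarith : ν < ev).ne', mul_zero]
  have hg1 : 0 < 1 - ev / s₀ := sub_pos.2 ((div_lt_one (hev0.trans hevs₀)).2 hevs₀)
  have hg2 : 0 < ev / s₁ - 1 := sub_pos.2 ((one_lt_div hs₁).2 hs₁ev)
  -- The gap in terms of the norm: `A 0 - ev C 0` is at most `-g ‖v‖²` on the lower spectral space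
  -- and at least `g ‖v‖²` on the complement of the upper one.
  set g := α * min (1 - ev / s₀) (ev / s₁ - 1) with hg
  have hg0 : 0 < g := mul_pos hα (lt_min hg1 hg2)
  set L := K₂ * (1 + ‖w‖) with hL
  have hL0 : 0 ≤ L := by positivity
  set M := K₁ + 2 * L ^ 2 / g with hM
  have hM0 : 0 ≤ M := by positivity
  -- The three bounds on `t` give validity of the expansions, `|± M t²| ≤ t`, and `L t ≤ g / 2`.
  refine ⟨M, min 1 (min (1 / (M + 1)) (g / 2 / (L + 1))), by positivity, fun t ht => ?_⟩
  have ht0 : 0 ≤ t := ht.1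
  have ht1 : t ≤ 1 := ht.2.trans (min_le_left _ _)
  have htM : M * t ≤ 1 := by
    have := (ht.2.trans (min_le_right _ _)).trans (min_le_left _ _)
    rw [le_div_iff₀ (by positivity)] at this
    linarith
  have htL : L * t ≤ g / 2 := by
    have := (ht.2.trans (min_le_right _ _)).trans (min_le_right _ _)
    rw [le_div_iff₀ (by positivity)] at this
    linarith
  have hPt := hP t ⟨ht0, ht1⟩
  have hMt : M * t ^ 2 ≤ t := by nlinarith
  have hMt0 : 0 ≤ M * t ^ 2 := by positivity
  have hexp : ∀ (σ r : ℝ) (v : H), A t (r • w + v) (r • w + v) - σ * C t (r • w + v) (r • w + v)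
      = r ^ 2 * (A t w w - σ * C t w w) + 2 * (r * (A t w v - σ * C t w v))
        + (A t v v - σ * C t v v) := fun σ r v => by
    simp only [map_add, map_smul, add_apply, smul_apply, smul_eq_mul, hPt.symmA v w, hPt.symmC v w]
    ring
  have hCw : ∀ v, A 0 w v = 0 → C 0 w v = 0 := fun v hv => by
    rw [hw.2] at hv
    exact (mul_eq_zero.1 hv).resolve_left hev0.ne'
  have hcross : ∀ ρ : ℝ, |ρ| ≤ t → ∀ (r : ℝ) (v : H), A 0 w v = 0 →
      |r * (A t w v - (ev + t * D + ρ) * C t w v)| ≤ L * t * |r| * ‖v‖ := fun ρ hρ r v hv => by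
    have h1 := (hbd t ⟨ht0, ht1⟩ ρ hρ).2 w v
    rw [hv, hCw v hv, mul_zero, sub_zero, sub_zero] at h1
    rw [abs_mul]
    calc |r| * _ ≤ |r| * (K₂ * t * (‖w‖ * ‖v‖)) := by gcongr
      _ ≤ |r| * (K₂ * t * ((1 + ‖w‖) * ‖v‖)) := by
        gcongr
        linarith
      _ = _ := by
        rw [hL]
        ring
  have hdiag : ∀ ρ : ℝ, |ρ| ≤ t → ∀ v, |A t v v - (ev + t * D + ρ) * C t v v
      - (A 0 v v - ev * C 0 v v)| ≤ L * t * ‖v‖ ^ 2 := fun ρ hρ v => by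
    refine ((hbd t ⟨ht0, ht1⟩ ρ hρ).2 v v).trans ?_
    rw [← sq]
    have : K₂ ≤ L := by
      rw [hL]
      nlinarith [norm_nonneg w]
    gcongr
  have hcoe' : ∀ v, g * ‖v‖ ^ 2 ≤ min (1 - ev / s₀) (ev / s₁ - 1) * A 0 v v := fun v => by
    calc g * ‖v‖ ^ 2 = min (1 - ev / s₀) (ev / s₁ - 1) * (α * ‖v‖ ^ 2) := by
          rw [hg]
          ring
      _ ≤ _ := mul_le_mul_of_nonneg_left (hcoe v) (lt_min hg1 hg2).le
  -- Trial space: the unperturbed spectral space up to `s₀`, that is, the lower eigenvectors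
  -- together with `w`. The shift `ρ = M t²` contributes `-M t²` in the `w` direction, which
  -- outweighs the errors.
  have hup : k ≤ Module.finrank ℝ (pencilSpace (A t) (C t) (ev + t * D + M * t ^ 2)) ∧
      pencilEigenvalue (A t) (C t) k ≤ ev + t * D + M * t ^ 2 := by
    refine hPt.eigenvalue_le hk hge fun x hx => ?_
    obtain ⟨v, hv, z, hz, rfl⟩ := Submodule.mem_sup.1 (hsup hx)
    obtain ⟨r, rfl⟩ := Submodule.mem_span_singleton.1 hz
    rw [add_comm v, ← sub_nonpos, hexp]
    have hρ : |M * t ^ 2| ≤ t := by rwa [abs_of_nonneg hMt0]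
    have b1 := abs_le.1 (hbd t ⟨ht0, ht1⟩ _ hρ).1
    have b3 := abs_le.1 (hcross _ hρ r v (horth v hv))
    have b4 := abs_le.1 (hdiag _ hρ v)
    have h1 : A 0 v v - ev * C 0 v v ≤ -(g * ‖v‖ ^ 2) := by
      have e1 := h0.le_of_mem_pencilSpace hv
      have e2 : ev / s₁ * A 0 v v ≤ ev * C 0 v v := by
        calc ev / s₁ * A 0 v v ≤ ev / s₁ * (s₁ * C 0 v v) := by gcongr
          _ = _ := by field_simp
      have e3 : g * ‖v‖ ^ 2 ≤ (ev / s₁ - 1) * A 0 v v :=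
        (hcoe' v).trans (mul_le_mul_of_nonneg_right (min_le_right _ _) (h0.nonnegA v))
      linarith
    have h2 := quadratic_nonneg (K₁ := K₁) (p := |r|) (q := ‖v‖) hg0 htL
    rw [sq_abs, ← hM] at h2
    have h3 := mul_le_mul_of_nonneg_left b1.2 (sq_nonneg r)
    linarith
  -- Constraint space: the unperturbed spectral space up to `s₁`, with orthogonality in `A 0`. After
  -- splitting off `w`, the rest is orthogonal to everything up to `s₀`, so the upper gap applies.
  have hlow : ev + t * D + -(M * t ^ 2) ≤ pencilEigenvalue (A t) (C t) k := by
    refine hPt.le_eigenvalue (A 0) ⟨_, hup.1⟩ hlt fun x hx => ?_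
    obtain ⟨r, v, rfl, hv⟩ : ∃ (r : ℝ) (v : H), x = r • w + v ∧ A 0 w v = 0 := by
      refine ⟨A 0 w x / ev, x - (A 0 w x / ev) • w, by abel, ?_⟩
      simp only [map_sub, map_smul, smul_eq_mul, hAw]
      field_simp
      simp
    have hvs : ∀ u ∈ pencilSpace (A 0) (C 0) s₀, A 0 v u = 0 := fun u hu => by
      obtain ⟨u', hu', z, hz, rfl⟩ := Submodule.mem_sup.1 (hsup hu)
      obtain ⟨c, rfl⟩ := Submodule.mem_span_singleton.1 hz
      have e1 := hx u' hu'
      simp only [map_add, map_smul, add_apply, smul_apply, smul_eq_mul, horth u' hu',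
        h0.symmA v w, hv] at e1 ⊢
      linarith
    rw [← sub_nonneg, hexp]
    have hρ : |-(M * t ^ 2)| ≤ t := by rwa [abs_neg, abs_of_nonneg hMt0]
    have b1 := abs_le.1 (hbd t ⟨ht0, ht1⟩ _ hρ).1
    have b3 := abs_le.1 (hcross _ hρ r v hv)
    have b4 := abs_le.1 (hdiag _ hρ v)
    have h1 : g * ‖v‖ ^ 2 ≤ A 0 v v - ev * C 0 v v := by
      by_cases hv0 : v = 0
      · simp [hv0]
      have e1 := (h0.lt_of_orthogonal hv0 hvs).le
      have e2 : ev * C 0 v v ≤ ev / s₀ * A 0 v v := by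
        calc ev * C 0 v v = ev / s₀ * (s₀ * C 0 v v) := by
              have := (hev0.trans hevs₀).ne'
              field_simp
          _ ≤ _ := mul_le_mul_of_nonneg_left e1 (div_pos hev0 (hev0.trans hevs₀)).le
      have e3 : g * ‖v‖ ^ 2 ≤ (1 - ev / s₀) * A 0 v v :=
        (hcoe' v).trans (mul_le_mul_of_nonneg_right (min_le_left _ _) (h0.nonnegA v))
      linarith
    have h2 := quadratic_nonneg (K₁ := K₁) (p := |r|) (q := ‖v‖) hg0 htL
    rw [sq_abs, ← hM] at h2
    have h3 := mul_le_mul_of_nonneg_left b1.1 (sq_nonneg r)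
    linarith
  rw [abs_le]
  constructor <;> linarith [hup.2]

end Perturbation

end IsPencil

end Pencil

/-! ### Translation, Poincaré and averaging estimates for test functions. -/

section Sobolev

open Set Metric
open scoped ENNReal Gradient

/-- The Cauchy--Schwarz inequality against the constant function `1`. -/
lemma sq_lintegral_le {α : Type*} [MeasurableSpace α] (μ : Measure α) {f : α → ℝ≥0∞}
    (hf : AEMeasurable f μ) : (∫⁻ x, f x ∂μ) ^ 2 ≤ μ univ * ∫⁻ x, f x ^ 2 ∂μ := by
  have h := ENNReal.lintegral_mul_le_Lp_mul_Lq μ Real.HolderConjugate.two_two hf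
    (aemeasurable_const (b := (1 : ℝ≥0∞)))
  simp only [Pi.mul_apply, mul_one, ENNReal.rpow_two, one_pow, lintegral_one] at h
  have hs : ∀ y : ℝ≥0∞, (y ^ (1 / 2 : ℝ)) ^ 2 = y := fun y => by
    rw [← ENNReal.rpow_natCast, ← ENNReal.rpow_mul]
    norm_num
  calc (∫⁻ x, f x ∂μ) ^ 2 ≤ ((∫⁻ x, f x ^ 2 ∂μ) ^ (1 / 2 : ℝ) * μ univ ^ (1 / 2 : ℝ)) ^ 2 := by
        gcongr
    _ = μ univ * ∫⁻ x, f x ^ 2 ∂μ := by rw [mul_pow, hs, hs, mul_comm]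

lemma enorm_add_sq_le (a b : ℝ) : ‖a + b‖ₑ ^ 2 ≤ 2 * ‖a‖ₑ ^ 2 + 2 * ‖b‖ₑ ^ 2 := by
  have h : (a + b) ^ 2 ≤ 2 * a ^ 2 + 2 * b ^ 2 := by nlinarith [sq_nonneg (a - b)]
  have e : ∀ c : ℝ, ‖c‖ₑ ^ 2 = ENNReal.ofReal (c ^ 2) := fun c => by
    rw [← ofReal_norm, ← ENNReal.ofReal_pow (norm_nonneg _), Real.norm_eq_abs, sq_abs]
  rw [e, e, e, ← ENNReal.ofReal_ofNat, ← ENNReal.ofReal_mul (by norm_num),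
    ← ENNReal.ofReal_mul (by norm_num), ← ENNReal.ofReal_add (by positivity) (by positivity)]
  exact ENNReal.ofReal_le_ofReal h

variable {d : ℕ}

lemma enorm_fderiv_apply_le (u : Space d → ℝ) (x h : Space d) :
    ‖fderiv ℝ u x h‖ₑ ≤ ‖h‖ₑ * ‖∇ u x‖ₑ := by
  rw [← inner_gradient_left, ← ofReal_norm, ← ofReal_norm,
    ← ofReal_norm, ← ENNReal.ofReal_mul (norm_nonneg _), mul_comm]
  exact ENNReal.ofReal_le_ofReal (norm_inner_le_norm _ _)

/-- The fundamental theorem of calculus on the segment from `x` to `x + h`, followed by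
Cauchy–Schwarz in the segment parameter. -/
lemma enorm_translate_sub_sq_le {u : Space d → ℝ} (hu : ContDiff ℝ ∞ u) (h x : Space d) :
    ‖u (x + h) - u x‖ₑ ^ 2
      ≤ ‖h‖ₑ ^ 2 * ∫⁻ s in Ioc (0 : ℝ) 1, ‖∇ u (x + s • h)‖ₑ ^ 2 := by
  have hd : ∀ s : ℝ, HasDerivAt (fun s : ℝ => u (x + s • h)) (fderiv ℝ u (x + s • h) h) s :=
    fun s => by
      have h1 : HasDerivAt (fun s : ℝ => x + s • h) h s := by
        simpa using ((hasDerivAt_id s).smul_const h).const_add x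
      exact ((hu.differentiable (by simp)).differentiableAt.hasFDerivAt.comp_hasDerivAt s h1)
  have hc : Continuous fun s : ℝ => fderiv ℝ u (x + s • h) h := by
    have := hu.continuous_fderiv (by simp)
    fun_prop
  have hg : Continuous fun s : ℝ => ‖∇ u (x + s • h)‖ₑ := by
    have h1 := hu.continuous_fderiv (by simp)
    have h2 : Continuous (∇ u) := (LinearIsometryEquiv.continuous _).comp h1
    fun_prop
  have hint : u (x + h) - u x = ∫ s in Ioc (0 : ℝ) 1, fderiv ℝ u (x + s • h) h := by
    rw [← intervalIntegral.integral_of_le zero_le_one,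
      intervalIntegral.integral_eq_sub_of_hasDerivAt (fun s _ => hd s)
        (hc.intervalIntegrable _ _)]
    simp
  rw [hint]
  calc ‖∫ s in Ioc (0 : ℝ) 1, fderiv ℝ u (x + s • h) h‖ₑ ^ 2
      ≤ (∫⁻ s in Ioc (0 : ℝ) 1, ‖fderiv ℝ u (x + s • h) h‖ₑ) ^ 2 := by
        gcongr
        exact enorm_integral_le_lintegral_enorm _
    _ ≤ (∫⁻ s in Ioc (0 : ℝ) 1, ‖h‖ₑ * ‖∇ u (x + s • h)‖ₑ) ^ 2 := by
        gcongr with s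
        exact enorm_fderiv_apply_le u _ _
    _ ≤ _ := by
        rw [lintegral_const_mul _ hg.measurable, mul_pow]
        gcongr
        refine (sq_lintegral_le _ hg.aemeasurable).trans ?_
        simp

lemma continuous_enorm_gradient {u : Space d → ℝ} (hu : ContDiff ℝ ∞ u) :
    Continuous fun x => ‖∇ u x‖ₑ := by
  have h1 := hu.continuous_fderiv (by simp)
  have h2 : Continuous (∇ u) := (LinearIsometryEquiv.continuous _).comp h1
  fun_prop

/-- The translation estimate in `L²`. -/
lemma lintegral_translate_sub_sq_le {u : Space d → ℝ} (hu : ContDiff ℝ ∞ u) (h : Space d) :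
    ∫⁻ x, ‖u (x + h) - u x‖ₑ ^ 2 ≤ ‖h‖ₑ ^ 2 * ∫⁻ x, ‖∇ u x‖ₑ ^ 2 := by
  have hg := continuous_enorm_gradient hu
  have hm : Measurable fun p : Space d × ℝ => ‖∇ u (p.1 + p.2 • h)‖ₑ ^ 2 :=
    (hg.comp (by fun_prop : Continuous fun p : Space d × ℝ => p.1 + p.2 • h)).measurable.pow_const 2
  calc ∫⁻ x, ‖u (x + h) - u x‖ₑ ^ 2
      ≤ ∫⁻ x, ‖h‖ₑ ^ 2 * ∫⁻ s in Ioc (0 : ℝ) 1, ‖∇ u (x + s • h)‖ₑ ^ 2 :=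
        lintegral_mono fun x => enorm_translate_sub_sq_le hu h x
    _ = ‖h‖ₑ ^ 2 * ∫⁻ x, ∫⁻ s in Ioc (0 : ℝ) 1, ‖∇ u (x + s • h)‖ₑ ^ 2 :=
        lintegral_const_mul _ hm.lintegral_prod_right'
    _ = ‖h‖ₑ ^ 2 * ∫⁻ s in Ioc (0 : ℝ) 1, ∫⁻ x, ‖∇ u (x + s • h)‖ₑ ^ 2 := by
        rw [lintegral_lintegral_swap hm.aemeasurable]
    _ = ‖h‖ₑ ^ 2 * ∫⁻ x, ‖∇ u x‖ₑ ^ 2 := by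
        simp [lintegral_add_right_eq_self fun x => ‖∇ u x‖ₑ ^ 2]

lemma IsTest.eq_zero {Ω : Set (Space d)} {u : Space d → ℝ} (hu : IsTest Ω u) {x : Space d}
    (hx : x ∉ Ω) : u x = 0 := image_eq_zero_of_notMem_tsupport fun h => hx (hu.2.2 h)

lemma IsTest.fderiv_eq_zero {Ω : Set (Space d)} {u : Space d → ℝ} (hu : IsTest Ω u) {x : Space d}
    (hx : x ∉ Ω) : fderiv ℝ u x = 0 := by
  by_contra h
  exact hx (hu.2.2 (support_fderiv_subset ℝ h))

lemma IsTest.gradient_eq_zero {Ω : Set (Space d)} {u : Space d → ℝ} (hu : IsTest Ω u)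
    {x : Space d} (hx : x ∉ Ω) : ∇ u x = 0 := by
  rw [gradient, hu.fderiv_eq_zero hx, map_zero]

lemma IsTest.lintegral_gradient {Ω : Set (Space d)} {u : Space d → ℝ} (hu : IsTest Ω u) :
    ∫⁻ x in Ω, ‖∇ u x‖ₑ ^ 2 = ∫⁻ x, ‖∇ u x‖ₑ ^ 2 :=
  setLIntegral_eq_of_support_subset fun x hx => by
    by_contra h
    simp [hu.gradient_eq_zero h] at hx

/-- The Poincaré inequality for test functions. -/
lemma exists_poincare_test (hd : 1 ≤ d) {Ω : Set (Space d)} (hΩ : Bornology.IsBounded Ω) :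
    ∃ K : ℝ≥0∞, K ≠ ⊤ ∧ ∀ u, IsTest Ω u →
      ∫⁻ x in Ω, ‖u x‖ₑ ^ 2 ≤ K * ∫⁻ x in Ω, ‖∇ u x‖ₑ ^ 2 := by
  obtain ⟨R, hR⟩ := hΩ.subset_ball (0 : Space d)
  -- A translation by the diameter of the ball moves `Ω` off itself, so `u (x + h) = 0` for `x ∈ Ω`
  -- and the translation estimate bounds `u` itself.
  set h : Space d := EuclideanSpace.single ⟨0, hd⟩ (2 * |R|) with hh
  have hnorm : ‖h‖ = 2 * |R| := by simp [hh]
  refine ⟨‖h‖ₑ ^ 2, by finiteness, fun u hu => ?_⟩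
  rw [hu.lintegral_gradient]
  have h1 : ∀ x, ‖u x‖ₑ ^ 2 ≤ ‖u (x + h) - u x‖ₑ ^ 2 := fun x => by
    by_cases hx : x ∈ Ω
    · rw [hu.eq_zero (x := x + h), zero_sub, enorm_neg]
      intro hxh
      have h2 := mem_ball_zero_iff.1 (hR hx)
      have h3 := mem_ball_zero_iff.1 (hR hxh)
      have h4 : ‖h‖ ≤ ‖x + h‖ + ‖x‖ := by
        have := norm_sub_le (x + h) x
        rwa [add_sub_cancel_left] at this
      rw [hnorm] at h4
      linarith [le_abs_self R]
    · rw [hu.eq_zero hx]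
      simp
  exact (setLIntegral_le_lintegral _ _).trans
    ((lintegral_mono h1).trans (lintegral_translate_sub_sq_le hu.1 h))

/-- A function is controlled by its translates and its mean value on a ball. -/
lemma enorm_sq_le_average {u : Space d → ℝ} (hu : Continuous u) (hs : HasCompactSupport u)
    {r : ℝ} (hr : 0 < r) {p x : Space d} (hx : x ∈ ball p r) :
    ‖u x‖ₑ ^ 2 ≤ 2 * ((volume (ball (0 : Space d) r))⁻¹ *
        ∫⁻ h in ball (0 : Space d) (2 * r), ‖u (x + h) - u x‖ₑ ^ 2)
      + 2 * ‖⨍ y in ball p r, u y‖ₑ ^ 2 := by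
  have hV : volume (ball p r) = volume (ball (0 : Space d) r) := Measure.addHaar_ball_center _ _ _
  have hV0 : volume (ball p r) ≠ 0 := (measure_ball_pos _ _ hr).ne'
  have hVt : volume (ball p r) ≠ ⊤ := measure_ball_lt_top.ne
  have hint : IntegrableOn u (ball p r) := (hu.integrable_of_hasCompactSupport hs).integrableOn
  have hic : IntegrableOn (fun _ => u x) (ball p r) := integrableOn_const hVt
  have hdiff : u x - ⨍ y in ball p r, u y = ⨍ y in ball p r, (u x - u y) := by
    rw [setAverage_eq, setAverage_eq, integral_sub hic hint, setIntegral_const, smul_sub, smul_smul,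
      inv_mul_cancel₀ (measureReal_ne_zero_iff hVt |>.2 hV0), one_smul]
  have hdecomp : u x = (u x - ⨍ y in ball p r, u y) + ⨍ y in ball p r, u y := by ring
  have hm : Measurable fun y => ‖u x - u y‖ₑ :=
    (by fun_prop : Continuous fun y => ‖u x - u y‖ₑ).measurable
  have hball : ball p r ⊆ ball x (2 * r) := fun y hy => by
    have h1 := mem_ball.1 hx
    have h2 := mem_ball.1 hy
    rw [mem_ball]
    have := dist_triangle_right y x p
    linarith
  have htrans : ∫⁻ y in ball x (2 * r), ‖u x - u y‖ₑ ^ 2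
      = ∫⁻ h in ball (0 : Space d) (2 * r), ‖u (x + h) - u x‖ₑ ^ 2 := by
    have hpre : (fun h => x + h) ⁻¹' ball x (2 * r) = ball (0 : Space d) (2 * r) := by
      ext h
      simp
    rw [← hpre, (measurePreserving_add_left volume x).setLIntegral_comp_preimage_emb
      (measurableEmbedding_addLeft x) (fun y => ‖u y - u x‖ₑ ^ 2)]
    simp_rw [enorm_sub_rev]
  have hkey : ‖u x - ⨍ y in ball p r, u y‖ₑ ^ 2 ≤ (volume (ball (0 : Space d) r))⁻¹ *
        ∫⁻ h in ball (0 : Space d) (2 * r), ‖u (x + h) - u x‖ₑ ^ 2 := by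
    rw [hdiff, setAverage_eq, enorm_smul, mul_pow, ← hV]
    have he : ‖(volume.real (ball p r))⁻¹‖ₑ = (volume (ball p r))⁻¹ := by
      rw [enorm_inv (measureReal_ne_zero_iff hVt |>.2 hV0), Real.enorm_of_nonneg measureReal_nonneg,
        ofReal_measureReal hVt]
    rw [he]
    calc (volume (ball p r))⁻¹ ^ 2 * ‖∫ y in ball p r, (u x - u y)‖ₑ ^ 2
        ≤ (volume (ball p r))⁻¹ ^ 2 * (∫⁻ y in ball p r, ‖u x - u y‖ₑ) ^ 2 := by
          gcongr
          exact enorm_integral_le_lintegral_enorm _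
      _ ≤ (volume (ball p r))⁻¹ ^ 2 *
          (volume (ball p r) * ∫⁻ y in ball p r, ‖u x - u y‖ₑ ^ 2) := by
          gcongr
          refine (sq_lintegral_le _ hm.aemeasurable).trans ?_
          rw [Measure.restrict_apply_univ]
      _ = (volume (ball p r))⁻¹ * ∫⁻ y in ball p r, ‖u x - u y‖ₑ ^ 2 := by
          rw [sq, ← mul_assoc, mul_assoc _ _ (volume (ball p r)), ENNReal.inv_mul_cancel hV0 hVt,
            mul_one]
      _ ≤ _ := by
          rw [← htrans]
          gcongr
  rw [hdecomp]
  refine (enorm_add_sq_le _ _).trans ?_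
  rw [← hdecomp]
  gcongr

/-- The `L²` norm of a test function is controlled by the gradient with a small constant, up to
finitely many mean values. -/
lemma lintegral_sq_le_gradient_add_average {Ω : Set (Space d)} {t : Finset (Space d)} {r : ℝ}
    (hr : 0 < r) (ht : Ω ⊆ ⋃ p ∈ t, ball p r) {u : Space d → ℝ} (hu : IsTest Ω u) :
    ∫⁻ x in Ω, ‖u x‖ₑ ^ 2 ≤ ENNReal.ofReal (2 * 2 ^ d * (2 * r) ^ 2) * (∫⁻ x in Ω, ‖∇ u x‖ₑ ^ 2)
      + 2 * volume Ω * ∑ p ∈ t, ‖⨍ y in ball p r, u y‖ₑ ^ 2 := by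
  set V := volume (ball (0 : Space d) r) with hV
  have hV0 : V ≠ 0 := (measure_ball_pos _ _ hr).ne'
  have hVt : V ≠ ⊤ := measure_ball_lt_top.ne
  have hc := hu.1.continuous
  have hm : Measurable fun q : Space d × Space d => ‖u (q.1 + q.2) - u q.1‖ₑ ^ 2 :=
    (by fun_prop : Continuous fun q : Space d × Space d => ‖u (q.1 + q.2) - u q.1‖ₑ).measurable.pow_const 2
  set Q := ∑ p ∈ t, ‖⨍ y in ball p r, u y‖ₑ ^ 2 with hQ
  have hpt : ∀ x, ‖u x‖ₑ ^ 2 ≤ 2 * (V⁻¹ *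
        ∫⁻ h in ball (0 : Space d) (2 * r), ‖u (x + h) - u x‖ₑ ^ 2) + 2 * Q := fun x => by
    by_cases hx : x ∈ Ω
    · obtain ⟨p, hp, hxp⟩ := mem_iUnion₂.1 (ht hx)
      refine (enorm_sq_le_average hc hu.2.1 hr hxp).trans ?_
      gcongr
      exact Finset.single_le_sum (f := fun p => ‖⨍ y in ball p r, u y‖ₑ ^ 2)
        (fun _ _ => zero_le) hp
    · rw [hu.eq_zero hx]
      simp
  -- Integrating in `x` first leaves the translation estimate for each `‖h‖ < 2r`. The ball of
  -- radius `2r` has volume `2 ^ d V`, and this `V` cancels the `V⁻¹` of the average.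
  have hdouble : ∫⁻ x, ∫⁻ h in ball (0 : Space d) (2 * r), ‖u (x + h) - u x‖ₑ ^ 2
      ≤ ENNReal.ofReal ((2 * r) ^ 2) * (ENNReal.ofReal (2 ^ d) * V) * ∫⁻ x in Ω, ‖∇ u x‖ₑ ^ 2 := by
    rw [lintegral_lintegral_swap hm.aemeasurable, hu.lintegral_gradient]
    calc ∫⁻ h in ball (0 : Space d) (2 * r), ∫⁻ x, ‖u (x + h) - u x‖ₑ ^ 2
        ≤ ∫⁻ h in ball (0 : Space d) (2 * r), ENNReal.ofReal ((2 * r) ^ 2) * ∫⁻ x, ‖∇ u x‖ₑ ^ 2 := by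
          refine setLIntegral_mono measurable_const fun h hh => ?_
          refine (lintegral_translate_sub_sq_le hu.1 h).trans ?_
          gcongr
          rw [← ofReal_norm, ← ENNReal.ofReal_pow (norm_nonneg _)]
          refine ENNReal.ofReal_le_ofReal ?_
          have := (mem_ball_zero_iff.1 hh).le
          gcongr
      _ = _ := by
          rw [setLIntegral_const, Measure.addHaar_ball_mul_of_pos _ _ (by norm_num : (0:ℝ) < 2),
            finrank_euclideanSpace_fin]
          ring
  have hmi : Measurable fun x : Space d => 2 * (V⁻¹ *
      ∫⁻ h in ball (0 : Space d) (2 * r), ‖u (x + h) - u x‖ₑ ^ 2) :=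
    (hm.lintegral_prod_right'.const_mul _).const_mul _
  calc ∫⁻ x in Ω, ‖u x‖ₑ ^ 2
      ≤ ∫⁻ x in Ω, (2 * (V⁻¹ *
        ∫⁻ h in ball (0 : Space d) (2 * r), ‖u (x + h) - u x‖ₑ ^ 2) + 2 * Q) := lintegral_mono hpt
    _ = (∫⁻ x in Ω, 2 * (V⁻¹ *
        ∫⁻ h in ball (0 : Space d) (2 * r), ‖u (x + h) - u x‖ₑ ^ 2)) + 2 * Q * volume Ω := by
        rw [lintegral_add_left hmi, setLIntegral_const]
    _ ≤ 2 * (V⁻¹ * (ENNReal.ofReal ((2 * r) ^ 2) * (ENNReal.ofReal (2 ^ d) * V)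
          * ∫⁻ x in Ω, ‖∇ u x‖ₑ ^ 2)) + 2 * Q * volume Ω := by
        rw [lintegral_const_mul _ (hm.lintegral_prod_right'.const_mul _),
          lintegral_const_mul _ hm.lintegral_prod_right']
        gcongr
        exact (setLIntegral_le_lintegral _ _).trans hdouble
    _ = (V⁻¹ * V) * (2 * ENNReal.ofReal (2 ^ d) * ENNReal.ofReal ((2 * r) ^ 2)
          * ∫⁻ x in Ω, ‖∇ u x‖ₑ ^ 2) + 2 * volume Ω * Q := by ring
    _ = _ := by
        rw [ENNReal.inv_mul_cancel hV0 hVt, one_mul, ENNReal.ofReal_mul (by positivity),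
          ENNReal.ofReal_mul (by positivity), ENNReal.ofReal_ofNat]

end Sobolev

/-! ### Poincaré inequality and compact embedding for `H¹₀(Ω)`, by density. -/

section H10

open Set Metric
open scoped ENNReal Gradient

lemma ofReal_norm_sq_eq_lintegral {α F : Type*} [MeasurableSpace α] {μ : Measure α}
    [NormedAddCommGroup F] (f : Lp F 2 μ) :
    ENNReal.ofReal (‖f‖ ^ 2) = ∫⁻ x, ‖f x‖ₑ ^ 2 ∂μ := by
  have h := eLpNorm_nnreal_pow_eq_lintegral (p := 2) (f := f) (μ := μ) two_ne_zero
  rw [ENNReal.ofReal_pow (norm_nonneg _), ofReal_norm, Lp.enorm_def]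
  simpa using h

variable {d : ℕ} {Ω : Set (Space d)}

lemma IsTest.add {u v : Space d → ℝ} (hu : IsTest Ω u) (hv : IsTest Ω v) : IsTest Ω (u + v) :=
  ⟨hu.1.add hv.1, hu.2.1.add hv.2.1, (tsupport_add u v).trans (union_subset hu.2.2 hv.2.2)⟩

lemma IsTest.smul {u : Space d → ℝ} (hu : IsTest Ω u) (r : ℝ) : IsTest Ω (r • u) :=
  ⟨contDiff_const.smul hu.1, hu.2.1.smul_left,
    (closure_mono (Function.support_const_smul_subset r u)).trans hu.2.2⟩

lemma isTest_zero : IsTest Ω 0 := ⟨contDiff_const, HasCompactSupport.zero, by simp⟩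

/-- A closed property of the test functions holds on all of `H¹₀`. -/
lemma H10_induction {P : L2Pair Ω → Prop} (hP : IsClosed {w | P w})
    (h : ∀ (w : L2Pair Ω) (η : Space d → ℝ), IsTest Ω η → w.fst =ᵐ[volume.restrict Ω] η →
      w.snd =ᵐ[volume.restrict Ω] ∇ η → P w) : ∀ w ∈ H10 Ω, P w := by
  -- The test functions already form a linear space, so taking the span adds nothing and only the
  -- closure remains.
  have key : ∀ w ∈ Submodule.span ℝ {w : L2Pair Ω | ∃ η : Space d → ℝ, IsTest Ω η ∧
      w.fst =ᵐ[volume.restrict Ω] η ∧ w.snd =ᵐ[volume.restrict Ω] fun x => ∇ η x},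
      ∃ η : Space d → ℝ, IsTest Ω η ∧
      w.fst =ᵐ[volume.restrict Ω] η ∧ w.snd =ᵐ[volume.restrict Ω] ∇ η := by
    intro w hw
    induction hw using Submodule.span_induction with
    | mem w hw => exact hw
    | zero =>
      refine ⟨0, isTest_zero, Lp.coeFn_zero _ _ _, (Lp.coeFn_zero _ _ _).trans ?_⟩
      refine Filter.Eventually.of_forall fun x => ?_
      simp [gradient]
    | add v w _ _ hv hw =>
      obtain ⟨η, hη, h1, h2⟩ := hv
      obtain ⟨ξ, hξ, h3, h4⟩ := hw
      refine ⟨η + ξ, hη.add hξ, (Lp.coeFn_add _ _).trans (h1.add h3),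
        (Lp.coeFn_add _ _).trans ((h2.add h4).trans ?_)⟩
      refine Filter.Eventually.of_forall fun x => ?_
      simp only [Pi.add_apply, gradient]
      rw [fderiv_add (hη.1.differentiable (by simp)).differentiableAt
        (hξ.1.differentiable (by simp)).differentiableAt, map_add]
    | smul r w _ hw =>
      obtain ⟨η, hη, h1, h2⟩ := hw
      refine ⟨r • η, hη.smul r, (Lp.coeFn_smul _ _).trans (h1.const_smul r),
        (Lp.coeFn_smul _ _).trans ((h2.const_smul r).trans ?_)⟩
      refine Filter.Eventually.of_forall fun x => ?_
      simp only [Pi.smul_apply, gradient]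
      rw [fderiv_const_smul (hη.1.differentiable (by simp)).differentiableAt, map_smul]
  refine fun w hw => closure_minimal (fun w hw => ?_) hP
    (show w ∈ closure ((Submodule.span ℝ {w : L2Pair Ω | ∃ η : Space d → ℝ, IsTest Ω η ∧
      w.fst =ᵐ[volume.restrict Ω] η ∧ w.snd =ᵐ[volume.restrict Ω] fun x => ∇ η x} :
        Submodule ℝ (L2Pair Ω)) : Set (L2Pair Ω)) from hw)
  obtain ⟨η, hη, h1, h2⟩ := key w hw
  exact h w η hη h1 h2

lemma continuous_fst_L2Pair : Continuous fun w : L2Pair Ω => w.fst :=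
  (WithLp.fstL 2 ℝ _ _).continuous

lemma continuous_snd_L2Pair : Continuous fun w : L2Pair Ω => w.snd :=
  (WithLp.sndL 2 ℝ _ _).continuous

lemma ofReal_norm_sq_eq_of_ae {F : Type*} [NormedAddCommGroup F]
    {f : Lp F 2 (volume.restrict Ω)} {η : Space d → F} (h : f =ᵐ[volume.restrict Ω] η) :
    ENNReal.ofReal (‖f‖ ^ 2) = ∫⁻ x in Ω, ‖η x‖ₑ ^ 2 := by
  rw [ofReal_norm_sq_eq_lintegral]
  exact lintegral_congr_ae (h.mono fun x hx => by simp only [hx])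

/-- The Poincaré inequality. -/
lemma exists_poincare (hd : 1 ≤ d) (hΩ : Bornology.IsBounded Ω) :
    ∃ K : ℝ, 0 ≤ K ∧ ∀ w ∈ H10 Ω, ‖w.fst‖ ^ 2 ≤ K * ‖w.snd‖ ^ 2 := by
  obtain ⟨K, hK, h⟩ := exists_poincare_test hd hΩ
  refine ⟨K.toReal, ENNReal.toReal_nonneg, H10_induction ?_ fun w η hη h1 h2 => ?_⟩
  · exact isClosed_le (continuous_fst_L2Pair.norm.pow 2)
      ((continuous_snd_L2Pair.norm.pow 2).const_mul _)
  · have := h η hη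
    rw [← ofReal_norm_sq_eq_of_ae h1, ← ofReal_norm_sq_eq_of_ae h2, ← ENNReal.ofReal_toReal hK,
      ← ENNReal.ofReal_mul ENNReal.toReal_nonneg] at this
    exact (ENNReal.ofReal_le_ofReal_iff (by positivity)).1 this

/-- The integral over a ball as a functional on `L²`. -/
def ballIntegral (Ω : Set (Space d)) (p : Space d) (r : ℝ) : L2Pair Ω →L[ℝ] ℝ :=
  (innerSL ℝ (indicatorConstLp 2 (measurableSet_ball (x := p) (ε := r))
    ((Measure.restrict_apply_le _ _).trans_lt measure_ball_lt_top).ne (1 : ℝ))).comp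
      (WithLp.fstL 2 ℝ _ _)

lemma ballIntegral_apply (p : Space d) (r : ℝ) (w : L2Pair Ω) :
    ballIntegral Ω p r w = ∫ x in ball p r, w.fst x ∂(volume.restrict Ω) :=
  L2.inner_indicatorConstLp_one _ _ _

/-- The compactness of the embedding of `H¹₀` in `L²`. -/
lemma exists_compactness (hΩ : Bornology.IsBounded Ω)
    {δ : ℝ} (hδ : 0 < δ) :
    ∃ (n : ℕ) (S : L2Pair Ω →L[ℝ] (Fin n → ℝ)) (K : ℝ), 0 ≤ K ∧ ∀ w ∈ H10 Ω,
      ‖w.fst‖ ^ 2 ≤ δ * ‖w.snd‖ ^ 2 + K * ‖S w‖ ^ 2 := by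
  -- The gradient constant of the averaging estimate scales like `r²`, so small balls make it at
  -- most `δ`; their number is finite because `Ω` is bounded.
  obtain ⟨r, hr, hrδ⟩ : ∃ r : ℝ, 0 < r ∧ 2 * 2 ^ d * (2 * r) ^ 2 ≤ δ := by
    have hc : (0 : ℝ) < 2 * 2 ^ d * 4 := by positivity
    refine ⟨√(δ / (2 * 2 ^ d * 4)), Real.sqrt_pos.2 (by positivity), ?_⟩
    rw [mul_pow, Real.sq_sqrt (by positivity)]
    field_simp
    norm_num
  obtain ⟨T, -, hT, hTΩ⟩ := exists_finite_cover_balls_of_isCompact_closure hΩ.isCompact_closure hr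
  lift T to Finset (Space d) using hT
  have hΩt : volume Ω ≠ ⊤ := hΩ.measure_lt_top.ne
  have hVt : volume (ball (0 : Space d) r) ≠ ⊤ := measure_ball_lt_top.ne
  set n := T.card with hn
  set v := volume.real (ball (0 : Space d) r) with hv
  let S : L2Pair Ω →L[ℝ] (Fin n → ℝ) :=
    ContinuousLinearMap.pi fun i => ballIntegral Ω (T.equivFin.symm i : Space d) r
  refine ⟨n, S, 2 * volume.real Ω * (n * v⁻¹ ^ 2), by positivity,
    H10_induction ?_ fun w η hη h1 h2 => ?_⟩
  · exact isClosed_le (continuous_fst_L2Pair.norm.pow 2)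
      (((continuous_snd_L2Pair.norm.pow 2).const_mul _).add ((S.continuous.norm.pow 2).const_mul _))
  · have havg : ∀ p, ⨍ y in ball p r, η y = v⁻¹ * ballIntegral Ω p r w := fun p => by
      have e1 : v = volume.real (ball p r) := by
        rw [hv, measureReal_def, measureReal_def, Measure.addHaar_ball_center _ p]
      rw [setAverage_eq, smul_eq_mul, ← e1, ballIntegral_apply,
        integral_congr_ae (ae_restrict_of_ae h1), Measure.restrict_restrict measurableSet_ball]
      congr 1
      exact setIntegral_eq_of_subset_of_forall_sdiff_eq_zero measurableSet_ball inter_subset_left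
        fun x hx => hη.eq_zero fun h => hx.2 ⟨hx.1, h⟩
    have hS : ∀ p ∈ T, ‖⨍ y in ball p r, η y‖ₑ ^ 2 ≤ ENNReal.ofReal (v⁻¹ ^ 2 * ‖S w‖ ^ 2) :=
      fun p hp => by
        have e2 : ‖ballIntegral Ω p r w‖ ≤ ‖S w‖ := by
          have := norm_le_pi_norm (S w) (T.equivFin ⟨p, hp⟩)
          simpa [S] using this
        rw [havg, ← ofReal_norm, ← ENNReal.ofReal_pow (norm_nonneg _), norm_mul, mul_pow,
          Real.norm_of_nonneg (by positivity : 0 ≤ v⁻¹)]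
        refine ENNReal.ofReal_le_ofReal ?_
        gcongr
    have hmain := lintegral_sq_le_gradient_add_average hr hTΩ hη
    rw [← ofReal_norm_sq_eq_of_ae h1, ← ofReal_norm_sq_eq_of_ae h2] at hmain
    have hsum := (Finset.sum_le_sum hS).trans (le_of_eq (Finset.sum_const _))
    rw [nsmul_eq_mul, ← hn, ← ENNReal.ofReal_natCast, ← ENNReal.ofReal_mul (by positivity)] at hsum
    have hvol : 2 * volume Ω = ENNReal.ofReal (2 * volume.real Ω) := by
      rw [ENNReal.ofReal_mul (by norm_num), ofReal_measureReal hΩt, ENNReal.ofReal_ofNat]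
    have hfin : ENNReal.ofReal (‖w.fst‖ ^ 2) ≤ ENNReal.ofReal (2 * 2 ^ d * (2 * r) ^ 2 * ‖w.snd‖ ^ 2
        + 2 * volume.real Ω * (n * (v⁻¹ ^ 2 * ‖S w‖ ^ 2))) := by
      rw [ENNReal.ofReal_add (by positivity) (by positivity),
        ENNReal.ofReal_mul (p := 2 * 2 ^ d * (2 * r) ^ 2) (by positivity),
        ENNReal.ofReal_mul (p := 2 * volume.real Ω) (by positivity), ← hvol]
      refine hmain.trans ?_
      gcongr
    have := (ENNReal.ofReal_le_ofReal_iff (by positivity)).1 hfin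
    refine this.trans ?_
    have h3 : 2 * 2 ^ d * (2 * r) ^ 2 * ‖w.snd‖ ^ 2 ≤ δ * ‖w.snd‖ ^ 2 := by gcongr
    linarith

end H10

/-! ### The weighted forms as a pencil on `H¹₀(Ω)`. -/

section Forms

open Set

variable {d : ℕ} {Ω : Set (Space d)}

/-- Essentially bounded measurable coefficients. -/
def IsBddCoeff (Ω : Set (Space d)) (f : Space d → ℝ) : Prop :=
  AEStronglyMeasurable f (volume.restrict Ω) ∧ ∃ M, ∀ᵐ x ∂(volume.restrict Ω), |f x| ≤ M

section Weighted

variable {F : Type*} [NormedAddCommGroup F] [InnerProductSpace ℝ F]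

lemma integrable_inner_of_memLp {α : Type*} [MeasurableSpace α] {μ : Measure α} {u v : α → F}
    (hu : MemLp u 2 μ) (hv : MemLp v 2 μ) : Integrable (fun x => (inner ℝ (u x) (v x) : ℝ)) μ :=
  (hu.norm.integrable_mul hv.norm).mono' (hu.1.inner hv.1)
    (Filter.Eventually.of_forall fun _ => norm_inner_le_norm _ _)

lemma IsBddCoeff.integrable {f : Space d → ℝ} (hf : IsBddCoeff Ω f) {u v : Space d → F}
    (hu : MemLp u 2 (volume.restrict Ω)) (hv : MemLp v 2 (volume.restrict Ω)) :
    Integrable (fun x => f x * inner ℝ (u x) (v x)) (volume.restrict Ω) := by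
  obtain ⟨M, hM⟩ := hf.2
  exact (integrable_inner_of_memLp hu hv).bdd_mul hf.1 hM

lemma integral_norm_mul_norm_le {F α : Type*} [NormedAddCommGroup F] [MeasurableSpace α] {μ : Measure α}
    (u v : Lp F 2 μ) : ∫ x, ‖u x‖ * ‖v x‖ ∂μ ≤ ‖u‖ * ‖v‖ := by
  have h := real_inner_le_norm ((Lp.memLp v).norm.toLp _) ((Lp.memLp u).norm.toLp _)
  rw [L2.inner_def, Lp.norm_toLp, Lp.norm_toLp, eLpNorm_norm, eLpNorm_norm, ← Lp.norm_def,
    ← Lp.norm_def, mul_comm] at h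
  refine le_trans (le_of_eq (integral_congr_ae ?_)) h
  filter_upwards [(Lp.memLp u).norm.coeFn_toLp, (Lp.memLp v).norm.coeFn_toLp] with x h1 h2
  rw [h1, h2]
  simp

lemma abs_wform_le {f : Space d → ℝ} {M : ℝ} (hM : ∀ᵐ x ∂(volume.restrict Ω), |f x| ≤ M)
    (u v : Lp F 2 (volume.restrict Ω)) : |wform Ω f u v| ≤ M * (‖u‖ * ‖v‖) := by
  have hint : Integrable (fun x => ‖u x‖ * ‖v x‖) (volume.restrict Ω) :=
    (Lp.memLp u).norm.integrable_mul (Lp.memLp v).norm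
  -- An almost everywhere bound forces `0 ≤ M` only if the measure is nonzero; for the zero measure
  -- both sides vanish.
  by_cases h0 : (volume.restrict Ω) univ = 0
  · have h1 : volume.restrict Ω = 0 := Measure.measure_univ_eq_zero.1 h0
    have h2 : ∀ w : Lp F 2 (volume.restrict Ω), ‖w‖ = 0 := fun w => by
      rw [Lp.norm_def]
      simp [h1]
    simp [wform, h1, h2]
  have hM0 : 0 ≤ M := by
    have : (ae (volume.restrict Ω)).NeBot := ae_neBot.2 fun h => h0 (by simp [h])
    obtain ⟨x, hx⟩ := hM.exists
    exact (abs_nonneg _).trans hx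
  calc |wform Ω f u v| ≤ ∫ x in Ω, ‖f x * inner ℝ (u x) (v x)‖ :=
        norm_integral_le_integral_norm (f := fun x => f x * inner ℝ (u x) (v x))
    _ ≤ ∫ x in Ω, M * (‖u x‖ * ‖v x‖) := by
        refine integral_mono_of_nonneg (Filter.Eventually.of_forall fun _ => norm_nonneg _)
          (hint.const_mul M) ?_
        filter_upwards [hM] with x hx
        rw [norm_mul]
        exact mul_le_mul hx (norm_inner_le_norm _ _) (norm_nonneg _) hM0
    _ ≤ M * (‖u‖ * ‖v‖) := by
        rw [integral_const_mul]
        exact mul_le_mul_of_nonneg_left (integral_norm_mul_norm_le u v) hM0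

lemma wform_comm (f : Space d → ℝ) (u v : Space d → F) : wform Ω f u v = wform Ω f v u := by
  simp only [wform, real_inner_comm]

lemma wform_add_left {f : Space d → ℝ} (hf : IsBddCoeff Ω f)
    (u v w : Lp F 2 (volume.restrict Ω)) :
    wform Ω f (u + v : Lp F 2 (volume.restrict Ω)) w = wform Ω f u w + wform Ω f v w := by
  rw [wform, wform, wform, ← integral_add (hf.integrable (Lp.memLp u) (Lp.memLp w))
    (hf.integrable (Lp.memLp v) (Lp.memLp w))]
  refine integral_congr_ae ((Lp.coeFn_add u v).mono fun x hx => ?_)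
  simp only [hx, Pi.add_apply, inner_add_left, mul_add]

lemma wform_smul_left (f : Space d → ℝ) (r : ℝ) (u w : Lp F 2 (volume.restrict Ω)) :
    wform Ω f (r • u : Lp F 2 (volume.restrict Ω)) w = r * wform Ω f u w := by
  rw [wform, wform, ← integral_const_mul]
  refine integral_congr_ae ((Lp.coeFn_smul r u).mono fun x hx => ?_)
  simp only [hx, Pi.smul_apply, real_inner_smul_left]
  ring

/-- The weighted form as a bounded bilinear form on `L²`. -/
def weightedForm (F : Type*) [NormedAddCommGroup F] [InnerProductSpace ℝ F] {f : Space d → ℝ}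
    (hf : IsBddCoeff Ω f) :
    Lp F 2 (volume.restrict Ω) →L[ℝ] Lp F 2 (volume.restrict Ω) →L[ℝ] ℝ :=
  LinearMap.mkContinuous₂
    (LinearMap.mk₂ ℝ (fun u v => wform Ω f u v) (wform_add_left hf) (wform_smul_left f)
      (fun u v w => by
        rw [wform_comm, wform_add_left hf, wform_comm f v, wform_comm f w])
      (fun r u v => by
        rw [wform_comm, wform_smul_left, wform_comm f v, smul_eq_mul]))
    hf.2.choose
    (fun u v => by
      rw [mul_assoc]
      exact abs_wform_le hf.2.choose_spec u v)

lemma mul_norm_sq_le_wform {f : Space d → ℝ} (hf : IsBddCoeff Ω f) {m : ℝ}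
    (hm : ∀ x, m ≤ f x) (u : Lp F 2 (volume.restrict Ω)) :
    m * ‖u‖ ^ 2 ≤ wform Ω f u u := by
  have h : ‖u‖ ^ 2 = ∫ x in Ω, inner ℝ (u x) (u x) := (real_inner_self_eq_norm_sq u).symm
  rw [h, ← integral_const_mul]
  refine integral_mono ((integrable_inner_of_memLp (Lp.memLp u) (Lp.memLp u)).const_mul m)
    (hf.integrable (Lp.memLp u) (Lp.memLp u)) fun x => ?_
  exact mul_le_mul_of_nonneg_right (hm x) real_inner_self_nonneg

/-- The error of a first order expansion of the weight. -/
lemma abs_wform_expansion_le {f g h : Space d → ℝ} (hf : IsBddCoeff Ω f) (hg : IsBddCoeff Ω g)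
    (hh : IsBddCoeff Ω h) {t M : ℝ}
    (hM : ∀ᵐ x ∂(volume.restrict Ω), |f x - g x - t * h x| ≤ M)
    (u v : Lp F 2 (volume.restrict Ω)) :
    |wform Ω f u v - wform Ω g u v - t * wform Ω h u v| ≤ M * (‖u‖ * ‖v‖) := by
  have e : wform Ω f u v - wform Ω g u v - t * wform Ω h u v
      = wform Ω (fun x => f x - g x - t * h x) u v := by
    rw [wform, wform, wform, wform, ← integral_const_mul, ← integral_sub, ← integral_sub]
    · congr 1
      ext x
      ring
    · exact (hf.integrable (Lp.memLp u) (Lp.memLp v)).sub (hg.integrable (Lp.memLp u) (Lp.memLp v))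
    · exact (hh.integrable (Lp.memLp u) (Lp.memLp v)).const_mul t
    · exact hf.integrable (Lp.memLp u) (Lp.memLp v)
    · exact hg.integrable (Lp.memLp u) (Lp.memLp v)
  rw [e]
  exact abs_wform_le hM u v

end Weighted

instance : CompleteSpace (H10 Ω) :=
  inferInstanceAs (CompleteSpace (Submodule.topologicalClosure _))

/-- The function of an element of `H¹₀(Ω)`. -/
def H10fst (Ω : Set (Space d)) : H10 Ω →L[ℝ] Lp ℝ 2 (volume.restrict Ω) :=
  (WithLp.fstL 2 ℝ _ _).comp (H10 Ω).subtypeL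

/-- The weak gradient of an element of `H¹₀(Ω)`. -/
def H10snd (Ω : Set (Space d)) : H10 Ω →L[ℝ] Lp (Space d) 2 (volume.restrict Ω) :=
  (WithLp.sndL 2 ℝ _ _).comp (H10 Ω).subtypeL

/-- The left-hand side of the weak formulation of the state equation. -/
def stiffness {f g : Space d → ℝ} (hf : IsBddCoeff Ω f) (hg : IsBddCoeff Ω g) :
    H10 Ω →L[ℝ] H10 Ω →L[ℝ] ℝ :=
  (weightedForm (Space d) hf).bilinearComp (H10snd Ω) (H10snd Ω)
    + (weightedForm ℝ hg).bilinearComp (H10fst Ω) (H10fst Ω)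

/-- The right-hand side of the weak formulation of the state equation. -/
def mass {f : Space d → ℝ} (hf : IsBddCoeff Ω f) : H10 Ω →L[ℝ] H10 Ω →L[ℝ] ℝ :=
  (weightedForm ℝ hf).bilinearComp (H10fst Ω) (H10fst Ω)

lemma stiffness_apply {f g : Space d → ℝ} (hf : IsBddCoeff Ω f) (hg : IsBddCoeff Ω g)
    (u v : H10 Ω) : stiffness hf hg u v
      = wform Ω f (u : L2Pair Ω).snd (v : L2Pair Ω).snd
        + wform Ω g (u : L2Pair Ω).fst (v : L2Pair Ω).fst := rfl

lemma mass_apply {f : Space d → ℝ} (hf : IsBddCoeff Ω f) (u v : H10 Ω) :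
    mass hf u v = wform Ω f (u : L2Pair Ω).fst (v : L2Pair Ω).fst := rfl

attribute [irreducible] stiffness mass

lemma H10_norm_sq (u : H10 Ω) :
    ‖u‖ ^ 2 = ‖(u : L2Pair Ω).fst‖ ^ 2 + ‖(u : L2Pair Ω).snd‖ ^ 2 :=
  WithLp.prod_norm_sq_eq_of_L2 (u : L2Pair Ω)

/-- Arithmetic of coercivity: `p` and `q` stand for the squared norms of function and gradient, `K`
for the Poincaré constant. -/
lemma div_mul_le_of_le {m K p q W : ℝ} (hK : 0 ≤ K) (hW : m * q ≤ W) (hp : m * p ≤ m * (K * q)) :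
    m / (1 + K) * (p + q) ≤ W := by
  rw [div_mul_eq_mul_div, div_le_iff₀ (by positivity)]
  nlinarith [mul_le_mul_of_nonneg_right hW (by positivity : 0 ≤ 1 + K)]

lemma le_add_of_le_div {M δ K p q s W : ℝ} (hM : 0 < M) (hδ : 0 ≤ δ) (hp : 0 ≤ p)
    (hW : W ≤ M * p) (h : p ≤ δ / M * q + K * s) : W ≤ δ * (p + q) + M * K * s := by
  have h1 := mul_le_mul_of_nonneg_left h hM.le
  have h2 : M * (δ / M * q + K * s) = δ * q + M * K * s := by field_simp
  nlinarith [mul_nonneg hδ hp]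

lemma stiffness_comm {f g : Space d → ℝ} (hf : IsBddCoeff Ω f) (hg : IsBddCoeff Ω g)
    (u v : H10 Ω) : stiffness hf hg u v = stiffness hf hg v u :=
  by
  rw [stiffness_apply hf hg u v, stiffness_apply hf hg v u, wform_comm f, wform_comm g]

lemma mass_comm {f : Space d → ℝ} (hf : IsBddCoeff Ω f) (u v : H10 Ω) :
    mass hf u v = mass hf v u := by
  rw [mass_apply hf u v, mass_apply hf v u, wform_comm f]

lemma mass_nonneg {f : Space d → ℝ} (hf : IsBddCoeff Ω f) (hf0 : ∀ x, 0 ≤ f x) (u : H10 Ω) :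
    0 ≤ mass hf u u :=
  (le_of_eq_of_le (zero_mul _).symm (mul_norm_sq_le_wform hf hf0 (u : L2Pair Ω).fst)).trans_eq
    (mass_apply hf u u).symm

lemma mul_norm_sq_le_stiffness {f g : Space d → ℝ} (hf : IsBddCoeff Ω f) (hg : IsBddCoeff Ω g)
    {m : ℝ} (hm : 0 < m) (hfm : ∀ x, m ≤ f x) (hg0 : ∀ x, 0 ≤ g x) {K : ℝ} (hK : 0 ≤ K)
    {u : H10 Ω} (hu : ‖(u : L2Pair Ω).fst‖ ^ 2 ≤ K * ‖(u : L2Pair Ω).snd‖ ^ 2) :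
    m / (1 + K) * ‖u‖ ^ 2 ≤ stiffness hf hg u u := by
  have h1 := mul_norm_sq_le_wform hf hfm (u : L2Pair Ω).snd
  have h2 := mul_norm_sq_le_wform hg hg0 (u : L2Pair Ω).fst
  rw [zero_mul] at h2
  have h3 := div_mul_le_of_le hK (h1.trans (le_add_of_nonneg_right h2))
    (mul_le_mul_of_nonneg_left hu hm.le)
  rw [H10_norm_sq u]
  exact h3.trans_eq (stiffness_apply hf hg u u).symm

lemma isCoercive_stiffness (hd : 1 ≤ d) (hΩ : Bornology.IsBounded Ω) {f g : Space d → ℝ}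
    (hf : IsBddCoeff Ω f) (hg : IsBddCoeff Ω g) {m : ℝ} (hm : 0 < m)
    (hfm : ∀ x, m ≤ f x) (hg0 : ∀ x, 0 ≤ g x) : IsCoercive (stiffness hf hg) := by
  obtain ⟨K, hK, hpoin⟩ := exists_poincare hd hΩ
  refine ⟨m / (1 + K), by positivity, fun u => ?_⟩
  refine le_of_eq_of_le ?_ (mul_norm_sq_le_stiffness hf hg hm hfm hg0 hK (hpoin u u.2))
  ring

lemma exists_compactness_mass (hΩ : Bornology.IsBounded Ω) {h : Space d → ℝ}
    (hh : IsBddCoeff Ω h) {δ : ℝ} (hδ : 0 < δ) :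
    ∃ (n : ℕ) (S : H10 Ω →L[ℝ] (Fin n → ℝ)) (K : ℝ),
      ∀ x, mass hh x x ≤ δ * ‖x‖ ^ 2 + K * ‖S x‖ ^ 2 := by
  obtain ⟨M, hM⟩ := hh.2
  obtain ⟨n, S, K, hK, hS⟩ := exists_compactness (Ω := Ω) hΩ (δ := δ / (|M| + 1)) (by positivity)
  refine ⟨n, S.comp (H10 Ω).subtypeL, (|M| + 1) * K, fun u => ?_⟩
  have h1 := (abs_le.1 (abs_wform_le hM (u : L2Pair Ω).fst (u : L2Pair Ω).fst)).2
  have h2 := hS u u.2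
  rw [H10_norm_sq]
  have h3 : M * (‖(u : L2Pair Ω).fst‖ * ‖(u : L2Pair Ω).fst‖)
      ≤ (|M| + 1) * ‖(u : L2Pair Ω).fst‖ ^ 2 := by
    rw [← sq]
    gcongr
    linarith [le_abs_self M]
  exact (mass_apply hh u u).trans_le
    (le_add_of_le_div (by positivity) hδ.le (sq_nonneg _) (h1.trans h3) h2)

/-- The forms of the eigenvalue problem are a pencil on `H¹₀(Ω)`. -/
lemma isPencil_forms (hd : 1 ≤ d) (hΩ : Bornology.IsBounded Ω) {f g h : Space d → ℝ}
    (hf : IsBddCoeff Ω f) (hg : IsBddCoeff Ω g) (hh : IsBddCoeff Ω h) {m : ℝ} (hm : 0 < m)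
    (hfm : ∀ x, m ≤ f x) (hg0 : ∀ x, 0 ≤ g x) (hh0 : ∀ x, 0 ≤ h x) :
    IsPencil (stiffness hf hg) (mass hh) where
  symmA := stiffness_comm hf hg
  symmC := mass_comm hh
  coercive := isCoercive_stiffness hd hΩ hf hg hm hfm hg0
  nonneg := mass_nonneg hh hh0
  compact _ := exists_compactness_mass hΩ hh

end Forms

/-! ### Dirichlet eigenvalues as pencil eigenvalues, and their expansion. -/

section Eigenvalue

open Set

variable {d : ℕ} {Ω : Set (Space d)} {a b c : ℝ → ℝ} {φ : Space d → ℝ}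

lemma isEigenfunction_iff (ha : IsBddCoeff Ω fun x => a (φ x)) (hb : IsBddCoeff Ω fun x => b (φ x))
    (hc : IsBddCoeff Ω fun x => c (φ x)) {ν : ℝ} {w : L2Pair Ω} :
    IsEigenfunction Ω a b c φ ν w
      ↔ ∃ hw : w ∈ H10 Ω, IsEigenvector (stiffness ha hb) (mass hc) ν ⟨w, hw⟩ := by
  constructor
  · rintro ⟨h0, hw, h⟩
    exact ⟨hw, fun h1 => h0 (congrArg Subtype.val h1), fun η =>
      (stiffness_apply ha hb _ η).trans ((h η η.2).trans
        (congrArg (ν * ·) (mass_apply hc ⟨w, hw⟩ η).symm))⟩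
  · rintro ⟨hw, h0, h⟩
    exact ⟨fun h1 => h0 (Subtype.ext h1), hw, fun η hη =>
      (stiffness_apply ha hb ⟨w, hw⟩ ⟨η, hη⟩).symm.trans ((h ⟨η, hη⟩).trans
        (congrArg (ν * ·) (mass_apply hc ⟨w, hw⟩ ⟨η, hη⟩)))⟩

lemma spectralSpace_eq (ha : IsBddCoeff Ω fun x => a (φ x)) (hb : IsBddCoeff Ω fun x => b (φ x))
    (hc : IsBddCoeff Ω fun x => c (φ x)) (t : ℝ) :
    spectralSpace Ω a b c φ t
      = (pencilSpace (stiffness ha hb) (mass hc) t).map (H10 Ω).subtype := by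
  rw [spectralSpace, pencilSpace, Submodule.map_span]
  congr 1
  ext w
  simp only [mem_ofPred_eq, mem_image]
  constructor
  · rintro ⟨ν, hν, h⟩
    obtain ⟨hw, h⟩ := (isEigenfunction_iff ha hb hc).1 h
    exact ⟨⟨w, hw⟩, ⟨ν, hν, h⟩, rfl⟩
  · rintro ⟨u, ⟨ν, hν, h⟩, rfl⟩
    exact ⟨ν, hν, (isEigenfunction_iff ha hb hc).2 ⟨u.2, h⟩⟩

lemma eigenvalue_eq (ha : IsBddCoeff Ω fun x => a (φ x)) (hb : IsBddCoeff Ω fun x => b (φ x))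
    (hc : IsBddCoeff Ω fun x => c (φ x)) (k : ℕ) :
    eigenvalue Ω a b c φ k = pencilEigenvalue (stiffness ha hb) (mass hc) k := by
  rw [eigenvalue, pencilEigenvalue]
  congr 1
  ext t
  rw [mem_ofPred_eq, mem_ofPred_eq, spectralSpace_eq ha hb hc]
  have := ((pencilSpace (stiffness ha hb) (mass hc) t).equivMapOfInjective (H10 Ω).subtype
    Subtype.val_injective).rank_eq
  rw [this]

lemma IsSimpleEigenvalue.exists_eigenfunction {ν : ℝ} (h : IsSimpleEigenvalue Ω a b c φ ν) :
    ∃ w, IsEigenfunction Ω a b c φ ν w := by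
  by_contra! hno
  have : eigenspace Ω a b c φ ν = ⊥ := by
    rw [eigenspace, Submodule.span_eq_bot]
    exact fun w hw => absurd hw (hno w)
  rw [IsSimpleEigenvalue, this, finrank_bot] at h
  exact zero_ne_one h

/-- The form in which simplicity enters `exists_eigenvalue_expansion`. -/
lemma IsSimpleEigenvalue.mem_span {ν : ℝ} (h : IsSimpleEigenvalue Ω a b c φ ν) {v w : L2Pair Ω}
    (hw : IsEigenfunction Ω a b c φ ν w) (hv : IsEigenfunction Ω a b c φ ν v) :
    v ∈ Submodule.span ℝ {w} := by
  have hw' : w ∈ eigenspace Ω a b c φ ν := Submodule.subset_span hw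
  have hv' : v ∈ eigenspace Ω a b c φ ν := Submodule.subset_span hv
  obtain ⟨r, hr⟩ := exists_smul_eq_of_finrank_eq_one h
    (x := (⟨w, hw'⟩ : eigenspace Ω a b c φ ν)) (fun h0 => hw.1 (congrArg Subtype.val h0)) ⟨v, hv'⟩
  exact Submodule.mem_span_singleton.2 ⟨r, congrArg Subtype.val hr⟩

lemma IsEigenfunction.smul {ν r : ℝ} {w : L2Pair Ω} (hw : IsEigenfunction Ω a b c φ ν w)
    (hr : r ≠ 0) : IsEigenfunction Ω a b c φ ν (r • w) := by
  refine ⟨smul_ne_zero hr hw.1, (H10 Ω).smul_mem r hw.2.1, fun η hη => ?_⟩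
  have h := hw.2.2 η hη
  rw [WithLp.smul_fst, WithLp.smul_snd, wform_smul_left, wform_smul_left, wform_smul_left]
  linear_combination r * h

/-- First order Taylor expansion with uniform remainder for functions of class `C^{1,1}`. -/
lemma IsC11Loc.exists_taylor {f : ℝ → ℝ} (hf : IsC11Loc f) :
    ∃ K : ℝ, 0 ≤ K ∧ ∀ x ∈ Icc (-1 : ℝ) 1, ∀ y ∈ Icc (-1 : ℝ) 1, ∀ t ∈ Icc (0 : ℝ) 1,
      |f (x + t * (y - x)) - f x - t * (deriv f x * (y - x))| ≤ K * t ^ 2 := by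
  obtain ⟨K, hK⟩ := (hf.2.locallyLipschitzOn (s := Icc (-1 : ℝ) 1)).exists_lipschitzOnWith_of_compact
    isCompact_Icc
  -- The remainder is at most `K |z - x|²` by the mean value inequality for `s ↦ f s - f'(x) s`, and
  -- `|z - x| ≤ 2t` on `[-1, 1]`.
  refine ⟨K * 4, by positivity, fun x hx y hy t ht => ?_⟩
  have hdiff : Differentiable ℝ f := hf.1.differentiable (by simp)
  set z := x + t * (y - x) with hz
  have hzI : z ∈ Icc (-1 : ℝ) 1 := by
    constructor <;> rw [hz] <;> nlinarith [hx.1, hx.2, hy.1, hy.2, ht.1, ht.2]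
  have hzx : |z - x| ≤ 2 * t := by
    rw [hz, add_sub_cancel_left, abs_mul, abs_of_nonneg ht.1, mul_comm]
    exact mul_le_mul_of_nonneg_right (abs_le.2 ⟨by linarith [hx.2, hy.1], by linarith [hx.1, hy.2]⟩)
      ht.1
  have hsub : uIcc x z ⊆ Icc (-1) 1 := uIcc_subset_Icc hx hzI
  have hbound : ∀ s ∈ uIcc x z, ‖deriv (fun s => f s - deriv f x * s) s‖ ≤ K * |z - x| := fun s hs => by
    have h1 : deriv (fun s => f s - deriv f x * s) s = deriv f s - deriv f x := by
      have h2 := (hdiff s).hasDerivAt.sub ((hasDerivAt_id s).const_mul (deriv f x))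
      rw [mul_one] at h2
      exact h2.deriv
    rw [h1]
    refine (hK.norm_sub_le (hsub hs) hx).trans ?_
    gcongr
    exact abs_sub_left_of_mem_uIcc hs
  have key := (convex_uIcc x z).norm_image_sub_le_of_norm_deriv_le
    (fun s _ => by fun_prop) hbound left_mem_uIcc right_mem_uIcc
  have e : f z - f x - t * (deriv f x * (y - x))
      = f z - deriv f x * z - (f x - deriv f x * x) := by
    rw [hz]
    ring
  rw [e]
  refine key.trans ?_
  rw [Real.norm_eq_abs, mul_assoc, mul_assoc]
  have h3 : |z - x| * |z - x| ≤ 2 * t * (2 * t) :=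
    mul_self_le_mul_self (abs_nonneg _) hzx
  have h4 : |z - x| * |z - x| ≤ 4 * t ^ 2 := h3.trans_eq (by ring)
  gcongr

lemma IsBddCoeff.comp {f : ℝ → ℝ} (hf : Continuous f) (hφ : IsBddCoeff Ω φ) :
    IsBddCoeff Ω fun x => f (φ x) := by
  obtain ⟨M, hM⟩ := hφ.2
  obtain ⟨N, hN⟩ := (isCompact_Icc (a := -M) (b := M)).exists_bound_of_continuousOn hf.continuousOn
  exact ⟨hf.comp_aestronglyMeasurable hφ.1, N, hM.mono fun x hx => hN _ (abs_le.1 hx)⟩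

lemma IsBddCoeff.add {f g : Space d → ℝ} (hf : IsBddCoeff Ω f) (hg : IsBddCoeff Ω g) :
    IsBddCoeff Ω fun x => f x + g x := by
  obtain ⟨M, hM⟩ := hf.2
  obtain ⟨N, hN⟩ := hg.2
  refine ⟨hf.1.add hg.1, M + N, ?_⟩
  filter_upwards [hM, hN] with x h1 h2
  exact (abs_add_le _ _).trans (add_le_add h1 h2)

lemma IsBddCoeff.mul {f g : Space d → ℝ} (hf : IsBddCoeff Ω f) (hg : IsBddCoeff Ω g) :
    IsBddCoeff Ω fun x => f x * g x := by
  obtain ⟨M, hM⟩ := hf.2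
  obtain ⟨N, hN⟩ := hg.2
  refine ⟨hf.1.mul hg.1, M * N, ?_⟩
  filter_upwards [hM, hN] with x h1 h2
  rw [abs_mul]
  exact mul_le_mul h1 h2 (abs_nonneg _) ((abs_nonneg _).trans h1)

lemma isBddCoeff_const (r : ℝ) : IsBddCoeff Ω fun _ => r :=
  ⟨aestronglyMeasurable_const, |r|, Filter.Eventually.of_forall fun _ => le_rfl⟩

lemma IsBddCoeff.sub {f g : Space d → ℝ} (hf : IsBddCoeff Ω f) (hg : IsBddCoeff Ω g) :
    IsBddCoeff Ω fun x => f x - g x := by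
  simpa [sub_eq_add_neg] using hf.add ((isBddCoeff_const (-1)).mul hg)

lemma norm_fst_le_H10 (u : H10 Ω) : ‖(u : L2Pair Ω).fst‖ ≤ ‖u‖ := by
  refine (abs_le_of_sq_le_sq' ?_ (norm_nonneg _)).2
  rw [H10_norm_sq]
  exact le_add_of_nonneg_right (sq_nonneg _)

lemma norm_snd_le_H10 (u : H10 Ω) : ‖(u : L2Pair Ω).snd‖ ≤ ‖u‖ := by
  refine (abs_le_of_sq_le_sq' ?_ (norm_nonneg _)).2
  rw [H10_norm_sq]
  exact le_add_of_nonneg_left (sq_nonneg _)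

lemma abs_add_expansion_le {s s' s'' p p' p'' q q' q'' t M M' N : ℝ} (h : s = p + q)
    (h' : s' = p' + q') (h'' : s'' = p'' + q'') (hp : |p - p' - t * p''| ≤ M * N)
    (hq : |q - q' - t * q''| ≤ M' * N) : |s - s' - t * s''| ≤ (M + M') * N := by
  subst h h' h''
  rw [abs_le] at *
  constructor <;> linarith

lemma abs_mass_expansion_le {f g h : Space d → ℝ} (hf : IsBddCoeff Ω f) (hg : IsBddCoeff Ω g)
    (hh : IsBddCoeff Ω h) {t M : ℝ} (hM0 : 0 ≤ M)
    (hM : ∀ᵐ x ∂(volume.restrict Ω), |f x - g x - t * h x| ≤ M) (x y : H10 Ω) :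
    |mass hf x y - mass hg x y - t * mass hh x y| ≤ M * (‖x‖ * ‖y‖) :=
by
  have h := (abs_wform_expansion_le hf hg hh hM (x : L2Pair Ω).fst (y : L2Pair Ω).fst).trans
    (mul_le_mul_of_nonneg_left (mul_le_mul (norm_fst_le_H10 x) (norm_fst_le_H10 y)
      (norm_nonneg _) (norm_nonneg _)) hM0)
  rwa [← mass_apply hf x y, ← mass_apply hg x y, ← mass_apply hh x y] at h

lemma abs_stiffness_expansion_le {f g h f' g' h' : Space d → ℝ} (hf : IsBddCoeff Ω f)
    (hg : IsBddCoeff Ω g) (hh : IsBddCoeff Ω h) (hf' : IsBddCoeff Ω f') (hg' : IsBddCoeff Ω g')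
    (hh' : IsBddCoeff Ω h') {t M M' : ℝ} (hM0 : 0 ≤ M) (hM0' : 0 ≤ M')
    (hM : ∀ᵐ x ∂(volume.restrict Ω), |f x - g x - t * h x| ≤ M)
    (hM' : ∀ᵐ x ∂(volume.restrict Ω), |f' x - g' x - t * h' x| ≤ M') (x y : H10 Ω) :
    |stiffness hf hf' x y - stiffness hg hg' x y - t * stiffness hh hh' x y|
      ≤ (M + M') * (‖x‖ * ‖y‖) := by
  have h1 : |wform Ω f (x : L2Pair Ω).snd (y : L2Pair Ω).snd
      - wform Ω g (x : L2Pair Ω).snd (y : L2Pair Ω).snd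
      - t * wform Ω h (x : L2Pair Ω).snd (y : L2Pair Ω).snd| ≤ M * (‖x‖ * ‖y‖) :=
    (abs_wform_expansion_le hf hg hh hM (x : L2Pair Ω).snd (y : L2Pair Ω).snd).trans
    (mul_le_mul_of_nonneg_left (mul_le_mul (norm_snd_le_H10 x) (norm_snd_le_H10 y)
      (norm_nonneg _) (norm_nonneg _)) hM0)
  have h2 : |wform Ω f' (x : L2Pair Ω).fst (y : L2Pair Ω).fst
      - wform Ω g' (x : L2Pair Ω).fst (y : L2Pair Ω).fst
      - t * wform Ω h' (x : L2Pair Ω).fst (y : L2Pair Ω).fst| ≤ M' * (‖x‖ * ‖y‖) :=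
    (abs_wform_expansion_le hf' hg' hh' hM' (x : L2Pair Ω).fst (y : L2Pair Ω).fst).trans
    (mul_le_mul_of_nonneg_left (mul_le_mul (norm_fst_le_H10 x) (norm_fst_le_H10 y)
      (norm_nonneg _) (norm_nonneg _)) hM0')
  exact abs_add_expansion_le (stiffness_apply hf hf' x y) (stiffness_apply hg hg' x y)
    (stiffness_apply hh hh' x y) h1 h2

set_option maxHeartbeats 1000000 in
/-- First order expansion of a simple Dirichlet eigenvalue along a segment of phase fields. -/
lemma exists_dirichlet_eigenvalue_expansion (hd : 1 ≤ d) (hΩ : Bornology.IsBounded Ω)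
    (ha : IsC11Loc a) (hb : IsC11Loc b) (hc : IsC11Loc c)
    (hac : ∃ C : ℝ, 0 < C ∧ ∀ s, C < a s ∧ C < c s) (hb_nonneg : ∀ s, 0 ≤ b s)
    {ϑ : Space d → ℝ} (hφ : AEStronglyMeasurable φ (volume.restrict Ω))
    (hφ1 : ∀ᵐ x ∂(volume.restrict Ω), |φ x| ≤ 1)
    (hϑ : AEStronglyMeasurable ϑ (volume.restrict Ω))
    (hϑ1 : ∀ᵐ x ∂(volume.restrict Ω), |ϑ x| ≤ 1) {k : ℕ} (hk : 1 ≤ k)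
    (hsimple : IsSimpleEigenvalue Ω a b c φ (eigenvalue Ω a b c φ k)) {w : L2Pair Ω}
    (hw : IsNormalizedEigenfunction Ω a b c φ (eigenvalue Ω a b c φ k) w) :
    ∃ M τ : ℝ, 0 < τ ∧ ∀ t ∈ Icc (0 : ℝ) τ,
      |eigenvalue Ω a b c (φ + t • (ϑ - φ)) k - eigenvalue Ω a b c φ k
        - t * (wform Ω (fun x => deriv a (φ x) * (ϑ x - φ x)) w.snd w.snd
          + wform Ω (fun x => deriv b (φ x) * (ϑ x - φ x)) w.fst w.fst
          - eigenvalue Ω a b c φ k *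
            wform Ω (fun x => deriv c (φ x) * (ϑ x - φ x)) w.fst w.fst)| ≤ M * t ^ 2 := by
  obtain ⟨m, hm, hac⟩ := hac
  have hφB : IsBddCoeff Ω φ := ⟨hφ, 1, hφ1⟩
  have hϑB : IsBddCoeff Ω ϑ := ⟨hϑ, 1, hϑ1⟩
  have hdB : IsBddCoeff Ω fun x => ϑ x - φ x := hϑB.sub hφB
  have hpB : ∀ t : ℝ, IsBddCoeff Ω (φ + t • (ϑ - φ)) := fun t =>
    hφB.add ((isBddCoeff_const t).mul hdB)
  have hB : ∀ {f : ℝ → ℝ}, IsC11Loc f → ∀ t : ℝ,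
      IsBddCoeff Ω fun x => f ((φ + t • (ϑ - φ)) x) := fun hf t => (hpB t).comp hf.1.continuous
  have hB' : ∀ {f : ℝ → ℝ}, IsC11Loc f → IsBddCoeff Ω fun x => deriv f (φ x) * (ϑ x - φ x) :=
    fun hf => (hφB.comp (hf.1.continuous_deriv le_rfl)).mul hdB
  have hexp : ∀ {f : ℝ → ℝ}, IsC11Loc f → ∃ K : ℝ, 0 ≤ K ∧ ∀ t ∈ Icc (0 : ℝ) 1,
      ∀ᵐ x ∂(volume.restrict Ω), |f ((φ + t • (ϑ - φ)) x) - f ((φ + (0 : ℝ) • (ϑ - φ)) x)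
        - t * (deriv f (φ x) * (ϑ x - φ x))| ≤ K * t ^ 2 := fun hf => by
    obtain ⟨K, hK0, hK⟩ := hf.exists_taylor
    refine ⟨K, hK0, fun t ht => ?_⟩
    filter_upwards [hφ1, hϑ1] with x h1 h2
    simpa using hK _ (abs_le.1 h1) _ (abs_le.1 h2) t ht
  obtain ⟨Ka, hKa0, hKa⟩ := hexp ha
  obtain ⟨Kb, hKb0, hKb⟩ := hexp hb
  obtain ⟨Kc, hKc0, hKc⟩ := hexp hc
  have hKab : ∀ t : ℝ, Ka * t ^ 2 + Kb * t ^ 2 ≤ (Ka + Kb + Kc) * t ^ 2 := fun t => by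
    linarith [mul_nonneg hKc0 (sq_nonneg t)]
  have hKc' : ∀ t : ℝ, Kc * t ^ 2 ≤ (Ka + Kb + Kc) * t ^ 2 := fun t => by
    linarith [mul_nonneg hKa0 (sq_nonneg t), mul_nonneg hKb0 (sq_nonneg t)]
  set A : ℝ → H10 Ω →L[ℝ] H10 Ω →L[ℝ] ℝ := fun t => stiffness (hB ha t) (hB hb t) with hAdef
  set C : ℝ → H10 Ω →L[ℝ] H10 Ω →L[ℝ] ℝ := fun t => mass (hB hc t) with hCdef
  have hP : ∀ t ∈ Icc (0 : ℝ) 1, IsPencil (A t) (C t) := fun t _ =>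
    isPencil_forms hd hΩ _ _ _ hm (fun x => (hac _).1.le) (fun x => hb_nonneg _)
      (fun x => (hm.trans (hac _).2).le)
  have hEA : ∀ t ∈ Icc (0 : ℝ) 1, ∀ x y, |A t x y - A 0 x y - t * stiffness (hB' ha) (hB' hb) x y|
      ≤ (Ka + Kb + Kc) * t ^ 2 * (‖x‖ * ‖y‖) := fun t ht x y =>
    (abs_stiffness_expansion_le (hB ha t) (hB ha 0) (hB' ha) (hB hb t) (hB hb 0) (hB' hb)
      (by positivity) (by positivity) (hKa t ht) (hKb t ht) x y).trans
      (mul_le_mul_of_nonneg_right (hKab t) (by positivity))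
  have hEC : ∀ t ∈ Icc (0 : ℝ) 1, ∀ x y, |C t x y - C 0 x y - t * mass (hB' hc) x y|
      ≤ (Ka + Kb + Kc) * t ^ 2 * (‖x‖ * ‖y‖) := fun t ht x y =>
    (abs_mass_expansion_le (hB hc t) (hB hc 0) (hB' hc) (by positivity) (hKc t ht) x y).trans
      (mul_le_mul_of_nonneg_right (hKc' t) (by positivity))
  have h00 : φ + (0 : ℝ) • (ϑ - φ) = φ := by simp
  have hev : eigenvalue Ω a b c φ k = pencilEigenvalue (A 0) (C 0) k :=
    (congrArg (fun ψ => eigenvalue Ω a b c ψ k) h00.symm).trans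
      (eigenvalue_eq (hB ha 0) (hB hb 0) (hB hc 0) k)
  set ev := eigenvalue Ω a b c φ k with hevdef
  have hiff : ∀ {v : L2Pair Ω}, IsEigenfunction Ω a b c φ ev v
      ↔ ∃ hv : v ∈ H10 Ω, IsEigenvector (A 0) (C 0) ev ⟨v, hv⟩ := fun {v} =>
    (congrArg (fun ψ => IsEigenfunction Ω a b c ψ ev v) h00.symm).to_iff.trans
      (isEigenfunction_iff (hB ha 0) (hB hb 0) (hB hc 0))
  obtain ⟨hwH, hwE⟩ := hiff.1 hw.1
  have hw1 : C 0 ⟨w, hwH⟩ ⟨w, hwH⟩ = 1 := by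
    refine (mass_apply (hB hc 0) _ _).trans ?_
    rw [h00]
    exact hw.2
  obtain ⟨M, τ, hτ, hM⟩ := IsPencil.exists_eigenvalue_expansion hP hEA hEC (by positivity) hk hev
    hwE hw1 (fun v hv => by
      obtain ⟨r, hr⟩ := Submodule.mem_span_singleton.1
        (hsimple.mem_span hw.1 (hiff.2 ⟨v.2, hv⟩))
      exact Submodule.mem_span_singleton.2 ⟨r, Subtype.ext hr⟩)
  refine ⟨M, τ, hτ, fun t ht => ?_⟩
  rw [eigenvalue_eq (hB ha t) (hB hb t) (hB hc t)]
  have h1 := hM t ht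
  rwa [stiffness_apply (hB' ha) (hB' hb) ⟨w, hwH⟩ ⟨w, hwH⟩,
    mass_apply (hB' hc) ⟨w, hwH⟩ ⟨w, hwH⟩] at h1

end Eigenvalue

/-! ### Weak gradients and the expansion of the energy. -/

section Energy

open Set Filter Topology

variable {d : ℕ} {U : Set (Space d)}

lemma IsTest.memLp {η : Space d → ℝ} (hη : IsTest U η) (μ : Measure (Space d))
    [IsFiniteMeasureOnCompacts μ] : MemLp η 2 μ :=
  hη.1.continuous.memLp_of_hasCompactSupport hη.2.1

lemma IsTest.memLp_fderiv {η : Space d → ℝ} (hη : IsTest U η) (v : Space d)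
    (μ : Measure (Space d)) [IsFiniteMeasureOnCompacts μ] :
    MemLp (fun x => fderiv ℝ η x v) 2 μ := by
  refine Continuous.memLp_of_hasCompactSupport ?_ (hη.2.1.fderiv_apply ℝ v)
  have := hη.1.continuous_fderiv (by simp)
  fun_prop

/-- The weak gradient is unique. -/
lemma HasWeakGrad.ae_eq (hU : IsOpen U) {u : Space d → ℝ} {g g' : Space d → Space d}
    (h : HasWeakGrad U u g) (h' : HasWeakGrad U u g') : g =ᵐ[volume.restrict U] g' := by
  have hmem : MemLp (g - g') 2 (volume.restrict U) := h.2.1.sub h'.2.1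
  have hloc : LocallyIntegrableOn (g - g') U volume :=
    locallyIntegrableOn_of_locallyIntegrable_restrict (hmem.locallyIntegrable one_le_two)
  -- The fundamental lemma of the calculus of variations; the vector-valued integral is tested
  -- against each direction `v`.
  have key := hU.ae_eq_zero_of_integral_contDiff_smul_eq_zero hloc fun η h1 h2 h3 => by
    have hη : IsTest U η := ⟨h1, h2, h3⟩
    have hint : Integrable (fun x => η x • (g - g') x) (volume.restrict U) :=
      memLp_one_iff_integrable.1 (hmem.smul (hη.memLp _))
    have e : ∫ x, η x • (g - g') x = ∫ x in U, η x • (g - g') x :=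
      (setIntegral_eq_integral_of_forall_compl_eq_zero fun x hx => by
        rw [hη.eq_zero hx, zero_smul]).symm
    rw [e]
    refine ext_inner_right ℝ fun v => ?_
    rw [inner_zero_left, real_inner_comm, ← integral_inner hint]
    have i1 : Integrable (fun x => inner ℝ (g x) v * η x) (volume.restrict U) :=
      (h.2.1.inner_const v).integrable_mul (hη.memLp _)
    have i2 : Integrable (fun x => inner ℝ (g' x) v * η x) (volume.restrict U) :=
      (h'.2.1.inner_const v).integrable_mul (hη.memLp _)
    have e1 := h.2.2 η hη v
    have e2 := h'.2.2 η hη v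
    have e3 : ∫ x in U, inner ℝ v (η x • (g - g') x)
        = ∫ x in U, (inner ℝ (g x) v * η x - inner ℝ (g' x) v * η x) := by
      congr 1
      ext x
      rw [real_inner_smul_right, Pi.sub_apply, inner_sub_right, real_inner_comm v, real_inner_comm v]
      ring
    rw [e3, integral_sub i1 i2]
    linarith
  filter_upwards [(ae_restrict_iff' hU.measurableSet).2 key] with x hx
  exact sub_eq_zero.1 hx

lemma HasWeakGrad.add_smul {u v : Space d → ℝ} {g h : Space d → Space d}
    (hu : HasWeakGrad U u g) (hv : HasWeakGrad U v h) (t : ℝ) :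
    HasWeakGrad U (u + t • v) (g + t • h) := by
  refine ⟨hu.1.add (hv.1.const_smul t), hu.2.1.add (hv.2.1.const_smul t), fun η hη z => ?_⟩
  have i1 : Integrable (fun x => u x * fderiv ℝ η x z) (volume.restrict U) :=
    hu.1.integrable_mul (hη.memLp_fderiv z _)
  have i2 : Integrable (fun x => v x * fderiv ℝ η x z) (volume.restrict U) :=
    hv.1.integrable_mul (hη.memLp_fderiv z _)
  have i3 : Integrable (fun x => inner ℝ (g x) z * η x) (volume.restrict U) :=
    (hu.2.1.inner_const z).integrable_mul (hη.memLp _)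
  have i4 : Integrable (fun x => inner ℝ (h x) z * η x) (volume.restrict U) :=
    (hv.2.1.inner_const z).integrable_mul (hη.memLp _)
  have e1 : ∀ x, (u + t • v) x * fderiv ℝ η x z
      = u x * fderiv ℝ η x z + t * (v x * fderiv ℝ η x z) := fun x => by
    simp only [Pi.add_apply, Pi.smul_apply, smul_eq_mul]
    ring
  have e2 : ∀ x, inner ℝ ((g + t • h) x) z * η x
      = inner ℝ (g x) z * η x + t * (inner ℝ (h x) z * η x) := fun x => by
    simp only [Pi.add_apply, Pi.smul_apply, inner_add_left, real_inner_smul_left]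
    ring
  simp_rw [e1, e2]
  rw [integral_add i1 (i2.const_mul t), integral_add i3 (i4.const_mul t), integral_const_mul,
    integral_const_mul, hu.2.2 η hη z, hv.2.2 η hη z]
  ring

lemma MemH1.hasWeakGrad {u : Space d → ℝ} (h : MemH1 U u) : HasWeakGrad U u (weakGrad U u) := by
  rw [weakGrad, dif_pos h]
  exact h.choose_spec

lemma MemH1.add_smul {u v : Space d → ℝ} (hu : MemH1 U u) (hv : MemH1 U v) (t : ℝ) :
    MemH1 U (u + t • v) := ⟨_, hu.hasWeakGrad.add_smul hv.hasWeakGrad t⟩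

lemma MemH1.sub {u v : Space d → ℝ} (hu : MemH1 U u) (hv : MemH1 U v) : MemH1 U (u - v) := by
  have := hu.add_smul hv (-1)
  rwa [neg_one_smul, ← sub_eq_add_neg] at this

/-- First order expansion of the energy along a segment of phase fields. -/
lemma exists_energy_expansion (hU : IsOpen U) (hUb : Bornology.IsBounded U) {ψ : ℝ → ℝ}
    (hψ : IsC11Loc ψ) (ε : ℝ) {φ ϑ : Space d → ℝ} (hφ : MemH1 U φ) (hϑ : MemH1 U ϑ)
    (hφ1 : ∀ᵐ x ∂(volume.restrict U), |φ x| ≤ 1) (hϑ1 : ∀ᵐ x ∂(volume.restrict U), |ϑ x| ≤ 1) :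
    ∃ M : ℝ, ∀ t ∈ Icc (0 : ℝ) 1, |energy U ψ ε (φ + t • (ϑ - φ)) - energy U ψ ε φ
      - t * (ε * (∫ x in U, inner ℝ (weakGrad U φ x) (weakGrad U (ϑ - φ) x))
        + 1 / ε * ∫ x in U, deriv ψ (φ x) * (ϑ x - φ x))| ≤ M * t ^ 2 := by
  obtain ⟨K, hK0, hK⟩ := hψ.exists_taylor
  have hUfin : volume U ≠ ⊤ := hUb.measure_lt_top.ne
  have : IsFiniteMeasure (volume.restrict U) := ⟨by simpa using hUb.measure_lt_top⟩
  have hdiff := hϑ.sub hφ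
  set g := weakGrad U φ with hg
  set h := weakGrad U (ϑ - φ) with hh
  have hgL : MemLp g 2 (volume.restrict U) := hφ.hasWeakGrad.2.1
  have hhL : MemLp h 2 (volume.restrict U) := hdiff.hasWeakGrad.2.1
  have hφB : IsBddCoeff U φ := ⟨hφ.hasWeakGrad.1.1, 1, hφ1⟩
  have hϑB : IsBddCoeff U ϑ := ⟨hϑ.hasWeakGrad.1.1, 1, hϑ1⟩
  have hint : ∀ {f : Space d → ℝ}, IsBddCoeff U f → Integrable f (volume.restrict U) :=
    fun hf => Integrable.of_bound hf.1 _ hf.2.choose_spec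
  refine ⟨|ε / 2| * (∫ x in U, ‖h x‖ ^ 2) + |1 / ε| * (K * volume.real U), fun t ht => ?_⟩
  have hpB : IsBddCoeff U (φ + t • (ϑ - φ)) :=
    hφB.add ((isBddCoeff_const t).mul (hϑB.sub hφB))
  -- `weakGrad` is a choice, so it is linear only almost everywhere, by uniqueness.
  have hgrad : weakGrad U (φ + t • (ϑ - φ)) =ᵐ[volume.restrict U] g + t • h :=
    HasWeakGrad.ae_eq hU (hφ.add_smul hdiff t).hasWeakGrad
      (hφ.hasWeakGrad.add_smul hdiff.hasWeakGrad t)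
  have i1 : Integrable (fun x => ‖g x‖ ^ 2) (volume.restrict U) := hgL.integrable_norm_pow two_ne_zero
  have i2 : Integrable (fun x => ‖h x‖ ^ 2) (volume.restrict U) := hhL.integrable_norm_pow two_ne_zero
  have i3 : Integrable (fun x => (inner ℝ (g x) (h x) : ℝ)) (volume.restrict U) :=
    integrable_inner_of_memLp hgL hhL
  have i4 := hint (hpB.comp hψ.1.continuous)
  have i5 := hint (hφB.comp hψ.1.continuous)
  have i6 := hint ((hφB.comp (hψ.1.continuous_deriv le_rfl)).mul (hϑB.sub hφB))
  have e1 : energy U ψ ε (φ + t • (ϑ - φ)) = ε / 2 * ((∫ x in U, ‖g x‖ ^ 2)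
      + 2 * t * (∫ x in U, inner ℝ (g x) (h x)) + t ^ 2 * ∫ x in U, ‖h x‖ ^ 2)
      + 1 / ε * ∫ x in U, ψ ((φ + t • (ϑ - φ)) x) := by
    have i7 : Integrable (fun x => ‖g x‖ ^ 2 + 2 * t * inner ℝ (g x) (h x)) (volume.restrict U) :=
      i1.add (i3.const_mul _)
    have i8 : Integrable (fun x => ‖g x‖ ^ 2 + 2 * t * inner ℝ (g x) (h x) + t ^ 2 * ‖h x‖ ^ 2)
      (volume.restrict U) := i7.add (i2.const_mul _)
    rw [← integral_const_mul, ← integral_const_mul, ← integral_add i1 (i3.const_mul _),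
      ← integral_add i7 (i2.const_mul _), ← integral_const_mul, ← integral_const_mul,
      ← integral_add (i8.const_mul _) (i4.const_mul _)]
    refine integral_congr_ae ?_
    filter_upwards [hgrad] with x hx
    simp only [hx]
    rw [Pi.add_apply, Pi.smul_apply, norm_add_sq_real, inner_smul_right, norm_smul, mul_pow,
      Real.norm_eq_abs, sq_abs]
    ring
  have e0 : energy U ψ ε φ = ε / 2 * (∫ x in U, ‖g x‖ ^ 2) + 1 / ε * ∫ x in U, ψ (φ x) := by
    rw [← integral_const_mul, ← integral_const_mul, ← integral_add (i1.const_mul _) (i5.const_mul _)]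
    rfl
  have e2 : (∫ x in U, ψ ((φ + t • (ϑ - φ)) x)) - (∫ x in U, ψ (φ x))
      - t * (∫ x in U, deriv ψ (φ x) * (ϑ x - φ x))
      = ∫ x in U, (ψ ((φ + t • (ϑ - φ)) x) - ψ (φ x) - t * (deriv ψ (φ x) * (ϑ x - φ x))) := by
    have i9 : Integrable (fun x => ψ ((φ + t • (ϑ - φ)) x) - ψ (φ x)) (volume.restrict U) :=
      i4.sub i5
    rw [← integral_const_mul, ← integral_sub i4 i5, ← integral_sub i9 (i6.const_mul t)]
  have e3 : |∫ x in U, (ψ ((φ + t • (ϑ - φ)) x) - ψ (φ x) - t * (deriv ψ (φ x) * (ϑ x - φ x)))|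
      ≤ K * t ^ 2 * volume.real U := by
    have := norm_integral_le_of_norm_le_const (μ := volume.restrict U) (C := K * t ^ 2)
      (f := fun x => ψ ((φ + t • (ϑ - φ)) x) - ψ (φ x) - t * (deriv ψ (φ x) * (ϑ x - φ x))) (by
        filter_upwards [hφ1, hϑ1] with x h1 h2
        simpa using hK _ (abs_le.1 h1) _ (abs_le.1 h2) t ht)
    simpa using this
  have e4 : energy U ψ ε (φ + t • (ϑ - φ)) - energy U ψ ε φ
      - t * (ε * (∫ x in U, inner ℝ (g x) (h x)) + 1 / ε * ∫ x in U, deriv ψ (φ x) * (ϑ x - φ x))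
      = ε / 2 * (t ^ 2 * ∫ x in U, ‖h x‖ ^ 2) + 1 / ε *
        ∫ x in U, (ψ ((φ + t • (ϑ - φ)) x) - ψ (φ x) - t * (deriv ψ (φ x) * (ϑ x - φ x))) := by
    rw [e1, e0, ← e2]
    ring
  have hh0 : 0 ≤ ∫ x in U, ‖h x‖ ^ 2 := integral_nonneg fun x => by positivity
  rw [e4]
  refine (abs_add_le _ _).trans ?_
  rw [abs_mul (ε / 2), abs_mul (1 / ε), abs_of_nonneg (mul_nonneg (sq_nonneg t) hh0)]
  have := mul_le_mul_of_nonneg_left e3 (abs_nonneg (1 / ε))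
  linarith

end Energy

/-! ### Convexity of the admissible set and one-sided derivatives. -/

section Optimality

open Set Filter Topology

variable {d : ℕ} {Ω S₀ S₁ : Set (Space d)} {β₁ β₂ : ℝ} {φ ϑ : Space d → ℝ}

/-- The constraint is imposed only on the free part; on `S₀` and `S₁` the values are `±1`. The
coefficients need the bound on all of `Ω`. -/
lemma MemU.abs_le_one (hφ : MemU Ω S₀ S₁ φ)
    (hV : ∀ᵐ x ∂(volume.restrict (freePart Ω S₀ S₁)), |φ x| ≤ 1) :
    ∀ᵐ x ∂(volume.restrict Ω), |φ x| ≤ 1 := by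
  have hsub : Ω ⊆ freePart Ω S₀ S₁ ∪ (S₀ ∪ S₁) := fun x hx => by
    by_cases h : x ∈ S₀ ∪ S₁
    · exact Or.inr h
    · exact Or.inl ⟨hx, h⟩
  refine ae_restrict_of_ae_restrict_of_subset hsub ?_
  rw [ae_restrict_union_iff, ae_restrict_union_iff]
  exact ⟨hV, hφ.2.1.mono fun x hx => by simp [hx], hφ.2.2.mono fun x hx => by simp [hx]⟩

lemma freePart_subset : freePart Ω S₀ S₁ ⊆ Ω := sdiff_subset

/-- The admissible phase fields form a convex set. -/
lemma Admissible.segment (hφ : Admissible Ω S₀ S₁ β₁ β₂ φ) (hϑ : Admissible Ω S₀ S₁ β₁ β₂ ϑ)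
    {t : ℝ} (ht : t ∈ Icc (0 : ℝ) 1) : Admissible Ω S₀ S₁ β₁ β₂ (φ + t • (ϑ - φ)) := by
  obtain ⟨⟨p1, p2, p3, p4⟩, p5, p6, p7⟩ := hφ
  obtain ⟨⟨q1, q2, q3, q4⟩, q5, q6, q7⟩ := hϑ
  have ht0 := ht.1
  have ht1 : 0 ≤ 1 - t := sub_nonneg.2 ht.2
  have i1 : IntegrableOn φ (freePart Ω S₀ S₁) := p5.mono_set freePart_subset
  have i2 : IntegrableOn ϑ (freePart Ω S₀ S₁) := q5.mono_set freePart_subset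
  have e : ∫ x in freePart Ω S₀ S₁, (φ + t • (ϑ - φ)) x
      = (1 - t) * (∫ x in freePart Ω S₀ S₁, φ x) + t * ∫ x in freePart Ω S₀ S₁, ϑ x := by
    rw [← integral_const_mul, ← integral_const_mul, ← integral_add (i1.const_mul _) (i2.const_mul _)]
    congr 1
    ext x
    simp only [Pi.add_apply, Pi.smul_apply, Pi.sub_apply, smul_eq_mul]
    ring
  refine ⟨⟨p1.add_smul (q1.sub p1) t, ?_, ?_, ?_⟩, p5.add ((q5.sub p5).smul t), ?_, ?_⟩
  · filter_upwards [p2, q2] with x h1 h2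
    rw [abs_le] at *
    simp only [Pi.add_apply, Pi.smul_apply, Pi.sub_apply, smul_eq_mul]
    constructor <;> nlinarith
  · rw [e]
    nlinarith
  · rw [e]
    nlinarith
  · filter_upwards [p6, q6] with x h1 h2
    simp [h1, h2]
  · filter_upwards [p7, q7] with x h1 h2
    simp [h1, h2]

/-- A function with a first order expansion is differentiable from the right. -/
lemma hasDerivWithinAt_of_expansion {f : ℝ → ℝ} {D M τ : ℝ} (hτ : 0 < τ)
    (h : ∀ t ∈ Icc (0 : ℝ) τ, |f t - f 0 - t * D| ≤ M * t ^ 2) :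
    HasDerivWithinAt f D (Ioi 0) 0 := by
  rw [hasDerivWithinAt_iff_tendsto_slope' (by simp)]
  have hlim : Tendsto (fun t : ℝ => M * t) (𝓝[>] 0) (𝓝 0) := by
    have : Tendsto (fun t : ℝ => M * t) (𝓝 0) (𝓝 (M * 0)) :=
      (continuous_const.mul continuous_id).tendsto 0
    rw [mul_zero] at this
    exact this.mono_left nhdsWithin_le_nhds
  rw [tendsto_iff_dist_tendsto_zero]
  refine squeeze_zero' (Eventually.of_forall fun _ => dist_nonneg) ?_ hlim
  filter_upwards [Ioc_mem_nhdsGT hτ] with t ht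
  have ht0 : 0 < t := ht.1
  have e : slope f 0 t - D = (f t - f 0 - t * D) / t := by
    have := ht0.ne'
    rw [slope_def_field, sub_zero]
    field_simp
  rw [Real.dist_eq, e, abs_div, abs_of_pos ht0, div_le_iff₀ ht0]
  exact (h t ⟨ht0.le, ht.2⟩).trans_eq (by ring)

lemma nonneg_of_hasDerivWithinAt {f : ℝ → ℝ} {D τ : ℝ} (hτ : 0 < τ)
    (hf : HasDerivWithinAt f D (Ioi 0) 0) (h : ∀ t ∈ Ioo (0 : ℝ) τ, f 0 ≤ f t) : 0 ≤ D := by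
  rw [hasDerivWithinAt_iff_tendsto_slope' (by simp)] at hf
  refine ge_of_tendsto hf ?_
  filter_upwards [Ioo_mem_nhdsGT hτ] with t ht
  rw [slope_def_field]
  exact div_nonneg (sub_nonneg.2 (h t ht)) (by linarith [ht.1])

lemma eLpNorm_segment_le (hφ : ∀ᵐ x ∂(volume.restrict Ω), |φ x| ≤ 1)
    (hϑ : ∀ᵐ x ∂(volume.restrict Ω), |ϑ x| ≤ 1) {t : ℝ} (ht : 0 ≤ t) :
    eLpNorm (φ + t • (ϑ - φ) - φ) ⊤ (volume.restrict Ω) ≤ ENNReal.ofReal (2 * t) := by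
  rw [eLpNorm_exponent_top, add_sub_cancel_left]
  refine eLpNormEssSup_le_of_ae_bound ?_
  filter_upwards [hφ, hϑ] with x h1 h2
  rw [Pi.smul_apply, Pi.sub_apply, norm_smul, Real.norm_of_nonneg ht, mul_comm]
  exact mul_le_mul_of_nonneg_right ((norm_sub_le _ _).trans (by
    rw [Real.norm_eq_abs, Real.norm_eq_abs]
    linarith)) ht

/-- An eigenfunction has a positive eigenvalue. -/
lemma IsEigenfunction.pos (hd : 1 ≤ d) (hΩ : Bornology.IsBounded Ω) {a b c : ℝ → ℝ}
    (ha : Continuous a) (hb : Continuous b) (hc : Continuous c)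
    (hac : ∃ C : ℝ, 0 < C ∧ ∀ s, C < a s ∧ C < c s) (hb_nonneg : ∀ s, 0 ≤ b s)
    (hφ : IsBddCoeff Ω φ) {ν : ℝ} {w : L2Pair Ω} (hw : IsEigenfunction Ω a b c φ ν w) : 0 < ν := by
  obtain ⟨m, hm, hac⟩ := hac
  obtain ⟨_, h⟩ := (isEigenfunction_iff (hφ.comp ha) (hφ.comp hb) (hφ.comp hc)).1 hw
  exact (isPencil_forms hd hΩ _ _ _ hm (fun x => (hac _).1.le) (fun x => hb_nonneg _)
    (fun x => (hm.trans (hac _).2).le)).eigenvalue_pos h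

lemma IsSimpleEigenvalue.exists_normalized (hd : 1 ≤ d) (hΩ : Bornology.IsBounded Ω)
    {a b c : ℝ → ℝ} (ha : Continuous a) (hb : Continuous b) (hc : Continuous c)
    (hac : ∃ C : ℝ, 0 < C ∧ ∀ s, C < a s ∧ C < c s) (hb_nonneg : ∀ s, 0 ≤ b s)
    (hφ : IsBddCoeff Ω φ) {ν : ℝ} (h : IsSimpleEigenvalue Ω a b c φ ν) :
    ∃ w, IsNormalizedEigenfunction Ω a b c φ ν w := by
  obtain ⟨m, hm, hac⟩ := hac
  obtain ⟨w, hw⟩ := h.exists_eigenfunction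
  obtain ⟨hwH, h⟩ := (isEigenfunction_iff (hφ.comp ha) (hφ.comp hb) (hφ.comp hc)).1 hw
  have hpos : 0 < wform Ω (fun x => c (φ x)) w.fst w.fst :=
    ((isPencil_forms hd hΩ _ _ _ hm (fun x => (hac _).1.le) (fun x => hb_nonneg _)
    (fun x => (hm.trans (hac _).2).le)).C_pos_of_eigenvector h).trans_eq (mass_apply _ _ _)
  set q := wform Ω (fun x => c (φ x)) w.fst w.fst with hq
  have hs := Real.mul_self_sqrt hpos.le
  have hs0 := (Real.sqrt_pos.2 hpos).ne'
  -- `q` is positive because `ν q = A(w, w) > 0` with `ν > 0`.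
  refine ⟨(√q)⁻¹ • w, hw.smul (inv_ne_zero hs0), ?_⟩
  rw [WithLp.smul_fst, wform_smul_left, wform_comm, wform_smul_left, ← hq]
  field_simp
  linarith

end Optimality

end PhaseField

end

/-! ### The variational inequality. -/

open PhaseField in
theorem mainTheorem7 {d : ℕ} (hd : 1 ≤ d)
    -- the design domain and the regions with prescribed phase
    (Ω S₀ S₁ : Set (Space d)) (hΩ_open : IsOpen Ω) (hΩ_bdd : Bornology.IsBounded Ω)
    (hΩ_ne : Ω.Nonempty) (hS₀ : MeasurableSet S₀) (hS₁ : MeasurableSet S₁)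
    (hS₀_sub : S₀ ⊆ Ω) (hS₁_sub : S₁ ⊆ Ω) (hS_disj : Disjoint S₀ S₁)
    (hfree : IsOpen (freePart Ω S₀ S₁))
    -- the bounds on the mean value
    (β₁ β₂ : ℝ) (hβ₁ : -1 < β₁) (hβ : β₁ ≤ β₂) (hβ₂ : β₂ < 1)
    -- the coefficient functions and the regular part of the potential
    (a b c ψ₀ : ℝ → ℝ) (ha : IsC11Loc a) (hb : IsC11Loc b) (hc : IsC11Loc c)
    (hψ₀ : IsC11Loc ψ₀) (hac : ∃ C : ℝ, 0 < C ∧ ∀ s, C < a s ∧ C < c s) (hb_nonneg : ∀ s, 0 ≤ b s)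
    (ε γ : ℝ) (hε : 0 < ε) (hγ : 0 < γ)
    -- the selected eigenvalues and the cost function
    {l : ℕ} (i : Fin l → ℕ) (hi_pos : ∀ j, 1 ≤ i j) (hi : StrictMono i)
    (Ψ : (Fin l → ℝ) → ℝ) (hΨ : ContDiffOn ℝ 1 Ψ {t | ∀ j, 0 < t j})
    -- the local minimizer
    (φ : Space d → ℝ) (hφ : IsLocalMinimizer Ω S₀ S₁ β₁ β₂ a b c ψ₀ ε γ i Ψ φ)
    (hsimple : ∀ j, IsSimpleEigenvalue Ω a b c φ (eigenvalue Ω a b c φ (i j))) :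
    (∀ j, ∃ w : L2Pair Ω, IsNormalizedEigenfunction Ω a b c φ (eigenvalue Ω a b c φ (i j)) w) ∧
    ∀ w : Fin l → L2Pair Ω,
      (∀ j, IsNormalizedEigenfunction Ω a b c φ (eigenvalue Ω a b c φ (i j)) (w j)) →
      (∀ j, IsWeakSol Ω a b c φ (eigenvalue Ω a b c φ (i j)) (w j)) ∧
      ∀ ϑ : Space d → ℝ, Admissible Ω S₀ S₁ β₁ β₂ ϑ →
        0 ≤ γ * ε * (∫ x in freePart Ω S₀ S₁,
                inner ℝ (weakGrad (freePart Ω S₀ S₁) φ x)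
                  (weakGrad (freePart Ω S₀ S₁) (ϑ - φ) x))
            + γ / ε * (∫ x in freePart Ω S₀ S₁, deriv ψ₀ (φ x) * (ϑ x - φ x))
            + ∑ j, fderiv ℝ Ψ (eigenvalueVector Ω a b c i φ) (Pi.single j 1) *
                (wform Ω (fun x => deriv a (φ x) * (ϑ x - φ x)) (w j).snd (w j).snd
                  + wform Ω (fun x => deriv b (φ x) * (ϑ x - φ x)) (w j).fst (w j).fst
                  - eigenvalue Ω a b c φ (i j) *
                    wform Ω (fun x => deriv c (φ x) * (ϑ x - φ x)) (w j).fst (w j).fst) := by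
  obtain ⟨hadm, δ, hδ, hmin⟩ := hφ
  have hφm := hadm.2.1.aestronglyMeasurable
  have hφ1 := hadm.2.abs_le_one hadm.1.2.1
  have hφB : IsBddCoeff Ω φ := ⟨hφm, 1, hφ1⟩
  have hac0 := ha.1.continuous
  have hbc0 := hb.1.continuous
  have hcc0 := hc.1.continuous
  refine ⟨fun j => (hsimple j).exists_normalized hd hΩ_bdd hac0 hbc0 hcc0 hac hb_nonneg hφB,
    fun w hw => ⟨fun j => (hw j).1.2, fun ϑ hϑ => ?_⟩⟩
  have hϑm := hϑ.2.1.aestronglyMeasurable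
  have hϑ1 := hϑ.2.abs_le_one hϑ.1.2.1
  have h00 : φ + (0 : ℝ) • (ϑ - φ) = φ := by simp
  set V := freePart Ω S₀ S₁ with hV
  set D : Fin l → ℝ := fun j =>
    wform Ω (fun x => deriv a (φ x) * (ϑ x - φ x)) (w j).snd (w j).snd
      + wform Ω (fun x => deriv b (φ x) * (ϑ x - φ x)) (w j).fst (w j).fst
      - eigenvalue Ω a b c φ (i j) *
        wform Ω (fun x => deriv c (φ x) * (ϑ x - φ x)) (w j).fst (w j).fst with hD
  have hvec : HasDerivWithinAt (fun t : ℝ => eigenvalueVector Ω a b c i (φ + t • (ϑ - φ))) D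
      (Set.Ioi 0) 0 := by
    refine hasDerivWithinAt_pi.2 fun j => ?_
    obtain ⟨M, τ, hτ, hM⟩ := exists_dirichlet_eigenvalue_expansion hd hΩ_bdd ha hb hc hac
      hb_nonneg hφm hφ1 hϑm hϑ1 (hi_pos j) (hsimple j) (hw j)
    refine hasDerivWithinAt_of_expansion (M := M) hτ fun t ht => ?_
    rw [h00]
    exact hM t ht
  -- `Ψ` is smooth only on the open positive orthant, which contains the eigenvalue vector.
  have hpos : ∀ j, 0 < eigenvalueVector Ω a b c i φ j := fun j =>
    (hw j).1.pos hd hΩ_bdd hac0 hbc0 hcc0 hac hb_nonneg hφB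
  have hopen : IsOpen {t : Fin l → ℝ | ∀ j, 0 < t j} := by
    simp only [Set.ofPred_forall]
    exact isOpen_iInter_of_finite fun j => isOpen_lt continuous_const (continuous_apply j)
  have hΨd : HasFDerivAt Ψ (fderiv ℝ Ψ (eigenvalueVector Ω a b c i φ))
      (eigenvalueVector Ω a b c i (φ + (0 : ℝ) • (ϑ - φ))) := by
    rw [h00]
    exact ((hΨ.contDiffAt (hopen.mem_nhds hpos)).differentiableAt (by simp)).hasFDerivAt
  have hfst := hΨd.comp_hasDerivWithinAt (0 : ℝ) hvec
  obtain ⟨M, hM⟩ := exists_energy_expansion hfree (hΩ_bdd.subset freePart_subset) hψ₀ ε hadm.1.1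
    hϑ.1.1 hadm.1.2.1 hϑ.1.2.1
  have hen : HasDerivWithinAt (fun t : ℝ => energy V ψ₀ ε (φ + t • (ϑ - φ)))
      (ε * (∫ x in V, inner ℝ (weakGrad V φ x) (weakGrad V (ϑ - φ) x))
        + 1 / ε * ∫ x in V, deriv ψ₀ (φ x) * (ϑ x - φ x)) (Set.Ioi 0) 0 := by
    refine hasDerivWithinAt_of_expansion (M := M) one_pos fun t ht => ?_
    rw [h00]
    exact hM t ht
  have hobj : HasDerivWithinAt
      (fun t : ℝ => objective Ω S₀ S₁ a b c ψ₀ ε γ i Ψ (φ + t • (ϑ - φ))) _ (Set.Ioi 0) 0 :=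
    hfst.add (hen.const_mul γ)
  -- `t < 1` keeps the segment admissible, and `2t < δ` keeps it in the neighbourhood of minimality.
  have hnonneg := nonneg_of_hasDerivWithinAt (τ := min 1 (δ / 2)) (by positivity) hobj
    fun t ht => by
      rw [h00]
      have ht1 : t < 1 := ht.2.trans_le (min_le_left _ _)
      have ht2 : t < δ / 2 := ht.2.trans_le (min_le_right _ _)
      refine hmin _ (hadm.segment hϑ ⟨ht.1.le, ht1.le⟩) ?_
      refine (eLpNorm_segment_le hφ1 hϑ1 ht.1.le).trans_lt ?_
      exact (ENNReal.ofReal_lt_ofReal_iff hδ).2 (by linarith)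
  have hsum : fderiv ℝ Ψ (eigenvalueVector Ω a b c i φ) D
      = ∑ j, fderiv ℝ Ψ (eigenvalueVector Ω a b c i φ) (Pi.single j 1) * D j := by
    conv_lhs => rw [pi_eq_sum_univ' D, map_sum]
    refine Finset.sum_congr rfl fun j _ => ?_
    rw [map_smul, smul_eq_mul, mul_comm]
  rw [hsum] at hnonneg
  refine hnonneg.trans_eq ?_
  ring
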